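/- **Setting.** Consider a finite-horizon MDP with state space $\mathcal S=[S]^d$, action set $[A]$, horizon $H$, transition kernel $T$, reward $R$ with values in $[0,1]$ and initial law $d_1$ ($d,S,A,H\ge 1$). For $s\in\mathcal S$ and $I\subseteq[d]$ write $s[I]=(s_i)_{i\in I}$. It is an ExoMDP with endogenous factors $I_\star\subseteq[d]$, $|I_\star|\le k$: $T(s'\mid s,a)=T_{en}(s'[I_\star]\mid s[I_\star],a)\,T_{ex}(s'[I_\star^c]\mid s[I_\star^c])$, $R(s,a)=R_{en}(s[I_\star],a)$ and $d_1(s)=d_{1,en}(s[I_\star])\,d_{1,ex}(s[I_\star^c])$. The set $I_\star$ is unknown to the learner; $k$ is known. A policy is $\pi=(\pi_1,\dots,\pi_H)$ with $\pi_i:\mathcal S\to[A]$, and $d_h(s[I];\pi)$ is the probability of $s_h[I]=s[I]$ under $\pi$. A one-step policy acts on $I$ if it depends on $s$ through $s[I]$ only; $\Pi[I]$ is the set of these, and $\Pi_{\le k}=\bigcup_{|I|\le k}\Pi[I]$. A policy is endogenous if every $\pi_i$ acts on $I_\star$. A finite set $\Psi$ of policies is an endogenous $\epsilon$-approximate policy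 cover for layer $h$ if all its members are endogenous and for every $s\in\mathcal S$ some $\psi\in\Psi$ has $d_h(s[I_\star];\psi)\ge\max_\pi d_h(s[I_\star];\pi)-\epsilon$. The endogenous state space is $\eta$-reachable: for all $h\in[H]$ and $s$, $\max_\pi d_h(s[I_\star];\pi)$ is either $0$ or at least $\eta$. **Algorithm $\mathsf{OSSR}_h^{\epsilon,\delta}$** (with constant $C$; input $k$ and policy sets $\Psi^{(1)},\dots,\Psi^{(h-1)}$; access to the MDP only by executing episodes). Let $N=\lceil C A S^{4k}H^2k^3\log(dSAH/\delta)\,\epsilon^{-2}\rceil$, $\epsilon_0=\frac1{16}\cdot\frac{\epsilon}{2S^kH}$, $I^{(h,h)}=\emptyset$, and let $\Psi^{(h,h)}$ consist of one fixed policy that plays a constant action (its actions have no effect on $s_h$). For $I_0\subseteq[d]$ let $\mathscr I(I_0)=\{I\supseteq I_0: |I|\le k\}$. For $t=h-1,\dots,1$, with $I_0=I^{(t+1,h)}$ and $\psi_s=\psi^{(t+1,h)}_{s[I_0]}$: 1. *Estimation.* Execute $N$ independent episodes: follow a uniformly drawn member of $\Psi^{(t)}$ before step $t$, play a uniform action $a_{t,n}$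 at step $t$, then follow a uniformly drawn $\psi_n\in\Psi^{(t+1,h)}$; record $(s_{t,n},a_{t,n},\psi_n,s_{h,n})$. Put $\hat d(s[I];\pi,\psi)=\frac1N\sum_{n}A\,|\Psi^{(t+1,h)}|\,\mathbf 1\{a_{t,n}=\pi(s_{t,n}),\psi_n=\psi,s_{h,n}[I]=s[I]\}$. 2. *Optimization.* For each $I\in\mathscr I(I_0)$ and $s[I]$, find $J$ of smallest size, $|J|\le k$, with $\max_{\pi\in\Pi_{\le k}}\hat d(s[I];\pi,\psi_s)\le\max_{\pi\in\Pi[J]}\hat d(s[I];\pi,\psi_s)+(1+\tfrac1k)^{k-|J|}\epsilon_0$, and let $\pi^{(t)}_{s[I]}$ be a maximizer of $\hat d(s[I];\cdot,\psi_s)$ over $\Pi[J]$. 3. *Selection.* Let $I^{(t,h)}$ be a set $I\in\mathscr I(I_0)$ of smallest size such that for all $J\in\mathscr I(I_0)$ and all $s[J]$, $\max_{\pi\in\Pi_{\le k}}\hat d(s[J];\pi,\psi_s)\le\hat d(s[J];\pi^{(t)}_{s[J\cap I]},\psi_s)+(1+\tfrac1k)^{k-|I|}5\epsilon_0$. If there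 is none, stop with failure. 4. *Composition.* Let $\psi^{(t,h)}_{s[I^{(t,h)}]}$ play $\pi^{(t)}_{s[I^{(t,h)}]}$ at step $t$ and then follow $\psi_s$; let $\Psi^{(t,h)}$ be the set of these policies. Return $\Psi^{(h)}=\Psi^{(1,h)}$. Ties in 2 and 3 are broken by an arbitrary fixed rule. **Theorem (sample complexity of OSSR).** There is an absolute constant $C_0>0$ such that for every $C\ge C_0$ there is $K>0$, depending only on $C$, with the following property. Let $\eta>0$, let an $\eta$-reachable ExoMDP with $|I_\star|\le k$ be given, and let $\epsilon\in(0,1]$, $\delta\in(0,1)$, $h\in[H]$. Suppose that $\mathsf{OSSR}_h^{\epsilon,\delta}$ is invoked with $\Psi^{(1)},\dots,\Psi^{(h-1)}$, where each $\Psi^{(t)}$ is an endogenous $\eta/2$-approximate policy cover for layer $t$ with $|\Psi^{(t)}|\le S^k$. Then with probability at least $1-\delta$ it does not fail and the returned set $\Psi^{(h)}$ is an endogenous $\epsilon$-approximate policy cover for layer $h$ with $|\Psi^{(h)}|\le S^k$. It has $h-1$ backward steps, and the total number of episodes it uses is always at most $$(h-1)\cdot K\,A\,S^{4k}H^2k^3\log\!\Big(\frac{dSAH}{\delta}\Big)\epsilon^{-2}.$$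 -/

import Mathlib

open scoped ENNReal

noncomputable section

namespace ExoRL

/-! ### Markov decision processes with a factored state space -/

/-- States `s = (s_1, …, s_d)`, each factor taking `S` values. The value `s[I]` of the factors in
`I` is `I.restrict s`. -/
abbrev State (d S : ℕ) : Type := Fin d → Fin S

/-- One-step policies: maps from states to actions. -/
abbrev OneStep (d S A : ℕ) : Type := State d S → Fin A

/-- Non-stationary policies `π = (π_1, …, π_H)`. The index `i : Fin H` is timestep `i + 1`. -/
abbrev Policy (d S A H : ℕ) : Type := Fin H → OneStep d S A

/-- A tabular MDP with `d` factors, `S` values per factor and `A` actions. -/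
structure MDP (d S A : ℕ) where
  /-- transition operator -/
  trans : State d S → Fin A → PMF (State d S)
  /-- reward function -/
  reward : State d S → Fin A → ℝ
  reward_mem : ∀ s a, reward s a ∈ Set.Icc (0 : ℝ) 1
  /-- initial state distribution -/
  init : PMF (State d S)

variable {d S A H : ℕ}

/-- `M` is an ExoMDP with endogenous factors `I`: transitions, rewards and initial distribution
factorize over `I` and its complement, and only the factors in `I` are affected by actions or
affect rewards. -/
def IsExoMDP (M : MDP d S A) (I : Finset (Fin d)) : Prop :=
  ∃ (Ten : (I → Fin S) → Fin A → PMF (I → Fin S))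
    (Tex : ((Iᶜ : Finset (Fin d)) → Fin S) → PMF ((Iᶜ : Finset (Fin d)) → Fin S))
    (Ren : (I → Fin S) → Fin A → ℝ)
    (den : PMF (I → Fin S))
    (dex : PMF ((Iᶜ : Finset (Fin d)) → Fin S)),
    (∀ s a s', M.trans s a s' =
      Ten (I.restrict s) a (I.restrict s') * Tex (Iᶜ.restrict s) (Iᶜ.restrict s')) ∧
    (∀ s a, M.reward s a = Ren (I.restrict s) a) ∧
    (∀ s, M.init s = den (I.restrict s) * dex (Iᶜ.restrict s))

/-- The law of the states at timesteps `1, …, n + 1` (coordinates `0, …, n`) of an episode in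
which the policy `π` is executed. -/
def episodeLaw (M : MDP d S A) (π : Policy d S A H) :
    (n : ℕ) → n < H → PMF (Fin (n + 1) → State d S)
  | 0, _ => M.init.map fun s _ => s
  | n + 1, hn =>
      (episodeLaw M π n (Nat.lt_of_succ_lt hn)).bind fun τ =>
        (M.trans (τ (Fin.last n)) (π ⟨n, Nat.lt_of_succ_lt hn⟩ (τ (Fin.last n)))).map fun s' =>
          Fin.snoc (α := fun _ => State d S) τ s'

/-- The occupancy `d_h(s[I] ; π)`: the probability that `s_h[I] = s[I]` when `π` is executed. -/
def occ (M : MDP d S A) (h : Fin H) (I : Finset (Fin d)) (s : State d S)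
    (π : Policy d S A H) : ℝ :=
  (((episodeLaw M π h h.isLt).map fun τ => I.restrict (τ (Fin.last h))) (I.restrict s)).toReal

/-- The one-step policy `π` acts on the factor set `I`. -/
def ActsOn (π : OneStep d S A) (I : Finset (Fin d)) : Prop :=
  ∀ s s' : State d S, I.restrict s = I.restrict s' → π s = π s'

/-- Endogenous policies act on the endogenous factors `Istar` at every timestep. -/
def IsEndogenous (Istar : Finset (Fin d)) (π : Policy d S A H) : Prop :=
  ∀ i, ActsOn (π i) Istar

/-- The endogenous state space is `η`-reachable. -/
def IsReachable (H : ℕ) (M : MDP d S A) (Istar : Finset (Fin d)) (η : ℝ) : Prop :=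
  ∀ (h : Fin H) (s : State d S),
    η ≤ (⨆ π : Policy d S A H, occ M h Istar s π) ∨
      (⨆ π : Policy d S A H, occ M h Istar s π) = 0

/-- `Ψ` is an endogenous `ε`-approximate policy cover for timestep `h`. -/
def IsEndoCover (M : MDP d S A) (Istar : Finset (Fin d)) (h : Fin H) (ε : ℝ)
    (Ψ : Finset (Policy d S A H)) : Prop :=
  (∀ s : State d S, ∃ ψ ∈ Ψ,
      (⨆ π : Policy d S A H, occ M h Istar s π) - ε ≤ occ M h Istar s ψ) ∧
    ∀ ψ ∈ Ψ, IsEndogenous Istar ψ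

/-! ### Collections of factor sets and policy classes -/

open Classical in
/-- All factor sets of size at most `k` that contain `I₀`. -/
def factorSets (k : ℕ) (I₀ : Finset (Fin d)) : Finset (Finset (Fin d)) :=
  Finset.univ.filter fun I => I₀ ⊆ I ∧ I.card ≤ k

open Classical in
/-- `Π[I]`: the one-step policies that act on `I`. -/
def policiesOn (I : Finset (Fin d)) : Finset (OneStep d S A) :=
  Finset.univ.filter fun π => ActsOn π I

open Classical in
/-- The one-step policies that act on some factor set of size at most `k`. -/
def policiesUpTo (k : ℕ) : Finset (OneStep d S A) :=
  Finset.univ.filter fun π => ∃ I ∈ factorSets k ∅, ActsOn π I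

/-- The maximum of `V` over a (finite, nonempty) class of one-step policies. -/
def policyMax (P : Finset (OneStep d S A)) (V : OneStep d S A → ℝ) : ℝ :=
  ⨆ π : {π // π ∈ P}, V π.1

/-! ### The two subroutines -/

/-- A rule that resolves the choices which the algorithm leaves open: which of several factor sets
of the same size is found first, and which maximizer is taken. -/
structure TieBreak (d S A : ℕ) where
  factor : Finset (Finset (Fin d)) → Finset (Fin d)
  factor_mem : ∀ F : Finset (Finset (Fin d)), F.Nonempty → factor F ∈ F
  policy : Finset (OneStep d S A) → OneStep d S A
  policy_mem : ∀ P : Finset (OneStep d S A), P.Nonempty → policy P ∈ P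

/-- The tolerance `(1 + 1/k)^(k - k') ε` for factor sets of size `k'`. -/
def tolerance (k : ℕ) (ε : ℝ) (k' : ℕ) : ℝ :=
  (1 + 1 / (k : ℝ)) ^ (k - k') * ε

open Classical in
/-- Bottom-up search: go through the sets in `factorSets k I₀` in order of increasing cardinality
and return the first one that satisfies `cond`; `none` means failure. -/
def factorSearch (tie : TieBreak d S A) (k : ℕ) (I₀ : Finset (Fin d))
    (cond : Finset (Fin d) → Prop) : Option (Finset (Fin d)) :=
  let hits := (factorSets k I₀).filter cond
  let least := hits.filter fun I => ∀ J ∈ hits, I.card ≤ J.card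
  if least.Nonempty then some (tie.factor least) else none

open Classical in
/-- `EndoPolicyOptimization` with precision `ε`, run on the value estimates `V`. -/
def endoPolicyOptimization (tie : TieBreak d S A) (k : ℕ) (ε : ℝ) (V : OneStep d S A → ℝ) :
    Option (OneStep d S A) :=
  (factorSearch tie k ∅ fun I =>
      policyMax (policiesUpTo k) V ≤ policyMax (policiesOn I) V + tolerance k ε I.card).map
    fun I => tie.policy ((policiesOn I).filter fun π => ∀ π' ∈ policiesOn I, V π' ≤ V π)

/-- `EndoFactorSelection` with precision `ε`. Here `I₀` and `ψ s` are the factor set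
`I^(t+1,h)` and the policy `ψ^(t+1,h)` at `s[I^(t+1,h)]`, `pol I s` is the one-step policy found for
the target `s[I]`, and `dhat I s π ψ` is the estimated probability that `s_h[I] = s[I]`. -/
def endoFactorSelection (tie : TieBreak d S A) (k : ℕ) (ε : ℝ) (I₀ : Finset (Fin d))
    (ψ : State d S → Policy d S A H) (pol : Finset (Fin d) → State d S → OneStep d S A)
    (dhat : Finset (Fin d) → State d S → OneStep d S A → Policy d S A H → ℝ) :
    Option (Finset (Fin d)) :=
  factorSearch tie k I₀ fun I =>
    ∀ J ∈ factorSets k I₀, ∀ s : State d S,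
      policyMax (policiesUpTo k) (fun π => dhat J s π (ψ s)) ≤
        dhat J s (pol (J ∩ I) s) (ψ s) + tolerance k (5 * ε) I.card

/-! ### Data collection -/

/-- `N` independent draws from `p`. -/
def iid {α : Type} [Fintype α] (p : PMF α) (N : ℕ) : PMF (Fin N → α) := by
  classical
  exact PMF.ofFintype (fun x => ∏ n, p (x n)) (by
    have h := Finset.prod_univ_sum (fun _ : Fin N => (Finset.univ : Finset α)) (fun _ a => p a)
    rw [Fintype.piFinset_univ] at h
    rw [← h]
    have h1 : ∑ a, p a = 1 := (tsum_fintype (L := .unconditional α) _).symm.trans p.tsum_coe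
    simp [h1])

/-- The composite policy: follow `φ` before layer `t`, the one-step policy `π` at layer `t`, and
`ψ` after layer `t`. -/
def compose (t : Fin H) (φ : Policy d S A H) (π : OneStep d S A) (ψ : Policy d S A H) :
    Policy d S A H :=
  fun i => if i < t then φ i else if i = t then π else ψ i

variable [NeZero A]

/-- The policy that always plays a fixed action. It is used only where the choice of the actions
is irrelevant (layers at or after the target layer). -/
def idlePolicy : Policy d S A H := fun _ _ => 0

open Classical in
/-- The uniform distribution on a finite nonempty set of policies. -/
def unif (Ψ : Finset (Policy d S A H)) : PMF (Policy d S A H) :=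
  if hΨ : Ψ.Nonempty then PMF.uniformOfFinset Ψ hΨ else PMF.pure idlePolicy

/-- A sample `(s_t, a_t, ψ, s_h)`. -/
abbrev Sample (d S A H : ℕ) : Type := State d S × Fin A × Policy d S A H × State d S

/-- One episode of data collection at layer `t`: draw `φ` uniformly from `Φ`, an action `a`
uniformly, and `ψ` uniformly from `Ψ`; follow `φ` up to layer `t`, play `a` there, and follow `ψ`
afterwards; record `(s_t, a, ψ, s_h)`. The environment is accessed only through `env`, which
returns the random states of layers `1, …, h` of an episode in which a given policy is executed. -/
def sampleLaw (h : Fin H) (env : Policy d S A H → PMF (Fin (h + 1) → State d S)) (t : Fin H)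
    (ht : t < h) (Φ Ψ : Finset (Policy d S A H)) : PMF (Sample d S A H) :=
  (unif Φ).bind fun φ =>
    (PMF.uniformOfFintype (Fin A)).bind fun a =>
      (unif Ψ).bind fun ψ =>
        (env (compose t φ (fun _ => a) ψ)).map fun τ =>
          (τ ⟨t, Nat.lt_succ_of_lt ht⟩, a, ψ, τ (Fin.last h))

open Classical in
/-- The importance-weighted estimate of `d_h(s[I] ; μ ∘_t π ∘_{t+1} ψ)`. -/
def estimate {N : ℕ} (D : Fin N → Sample d S A H) (Ψ : Finset (Policy d S A H))
    (I : Finset (Fin d)) (s : State d S) (π : OneStep d S A) (ψ : Policy d S A H) : ℝ :=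
  (1 / (N : ℝ)) * ∑ n,
    (if (D n).2.1 = π (D n).1 ∧ (D n).2.2.1 = ψ ∧ I.restrict (D n).2.2.2 = I.restrict s
      then (1 : ℝ) else 0) / ((1 / (A : ℝ)) * (1 / (Ψ.card : ℝ)))

/-! ### The algorithm -/

/-- The factor set `I = I^(t,h)` together with the policies `ψ s = ψ^(t,h)` at `s[I^(t,h)]`. -/
structure Stage (d S A H : ℕ) where
  factors : Finset (Fin d)
  ψ : State d S → Policy d S A H

open Classical in
/-- The set of policies `Ψ^(t,h)`. -/
def Stage.policies (x : Stage d S A H) : Finset (Policy d S A H) :=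
  Finset.univ.image x.ψ

/-- The optimization phase, selection phase and policy composition at layer `t`, given the
data `D`; `none` means that a subroutine has failed. -/
def refineStage (tie : TieBreak d S A) (k : ℕ) (ε₀ : ℝ) (t : Fin H) {N : ℕ}
    (D : Fin N → Sample d S A H) (x : Stage d S A H) : Option (Stage d S A H) := by
  classical
  exact
    let dhat := estimate D x.policies
    let opt := fun (I : Finset (Fin d)) (s : State d S) =>
      endoPolicyOptimization tie k ε₀ fun π => dhat I s π (x.ψ s)
    if ∀ I ∈ factorSets k x.factors, ∀ s, (opt I s).isSome then
      let pol := fun (I : Finset (Fin d)) (s : State d S) => (opt I s).getD fun _ => 0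
      (endoFactorSelection tie k ε₀ x.factors x.ψ pol dhat).map fun I =>
        { factors := I
          ψ := fun s => compose t idlePolicy (pol I s) (x.ψ s) }
    else none

/-- The outcome of a run: the current stage (`none` after a failure) and the number of episodes
executed so far. -/
structure Run (d S A H : ℕ) where
  stage : Option (Stage d S A H)
  episodes : ℕ

/-- One backward step: draw `N` episodes at layer `t` and refine. After a failure the run stops. -/
def backwardStep (tie : TieBreak d S A) (k : ℕ) (ε₀ : ℝ) (N : ℕ) (h : Fin H)
    (env : Policy d S A H → PMF (Fin (h + 1) → State d S))
    (Ψ : Fin H → Finset (Policy d S A H)) (t : Fin H) (ht : t < h) (r : Run d S A H) :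
    PMF (Run d S A H) :=
  match r.stage with
  | none => PMF.pure r
  | some x =>
      (iid (sampleLaw h env t ht (Ψ t) x.policies) N).map fun D =>
        { stage := refineStage tie k ε₀ t D x, episodes := r.episodes + N }

/-- The backward steps at the layers with indices `m - 1, m - 2, …, 0`. -/
def backwardSteps (tie : TieBreak d S A) (k : ℕ) (ε₀ : ℝ) (N : ℕ) (h : Fin H)
    (env : Policy d S A H → PMF (Fin (h + 1) → State d S))
    (Ψ : Fin H → Finset (Policy d S A H)) :
    (m : ℕ) → m ≤ (h : ℕ) → Run d S A H → PMF (Run d S A H)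
  | 0, _, r => PMF.pure r
  | m + 1, hm, r =>
      (backwardStep tie k ε₀ N h env Ψ ⟨m, lt_trans (Nat.lt_of_succ_le hm) h.isLt⟩
          (Fin.lt_def.mpr (Nat.lt_of_succ_le hm)) r).bind
        (backwardSteps tie k ε₀ N h env Ψ m (Nat.le_of_succ_le hm))

/-- The expression `A S^(4k) H² k³ log(dSAH/δ) ε⁻²`. -/
def rate (d S A H k : ℕ) (ε δ : ℝ) : ℝ :=
  A * (S : ℝ) ^ (4 * k) * (H : ℝ) ^ 2 * (k : ℝ) ^ 3 * Real.log (d * S * A * H / δ) / ε ^ 2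

/-- `OSSR_h^{ε,δ}` with constant `C`, run in the environment `env` on the policy covers
`Ψ t`, `t < h`: in every backward step `N = ⌈C A S^(4k) H² k³ log(dSAH/δ) ε⁻²⌉` episodes are drawn,
and the subroutines run with precision `ε₀ = ε / (2 S^k H) / 16`. The result is the law of
the returned policy set (`none` for failure) and of the number of episodes used. -/
def ossr (C : ℝ) (tie : TieBreak d S A) (k : ℕ) (ε δ : ℝ) (h : Fin H)
    (env : Policy d S A H → PMF (Fin (h + 1) → State d S))
    (Ψ : Fin H → Finset (Policy d S A H)) :
    PMF (Option (Finset (Policy d S A H)) × ℕ) :=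
  (backwardSteps tie k (ε / (2 * (S : ℝ) ^ k * H) / 16) ⌈C * rate d S A H k ε δ⌉₊ h env Ψ
      h le_rfl { stage := some { factors := ∅, ψ := fun _ => idlePolicy }, episodes := 0 }).map
    fun r => (r.stage.map Stage.policies, r.episodes)

end ExoRL

end

/-!
# Sample complexity of OSSR

Fix a layer `t` and let the roll-in policies and the roll-out policy `ψ` be endogenous. Then the
endogenous and the exogenous factors evolve independently, and the probability of a target `s[J]`, as
a function of the one-step policy `π` at layer `t`, is a mixture over the exogenous factors `y` of
values `∑ x, W x (π (x, y))` (`exists_mixValue_eq`). This has two consequences. Freezing `y` at its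
most favourable value shows that a policy on `K` is dominated by one on `K ∩ I⋆`
(`mixValue_restrict`); and on endogenous policies the value of `s[J]` is a multiple, by a factor in
`[0, 1]`, of the value of its endogenous part `s[J ∩ I⋆]` (`mixValue_factor`).

If all estimates are within `ε₀ / (2k)` of these values, the two consequences show that whenever
a factor set `I` passes one of the tests of the bottom-up searches, its endogenous part `I ∩ I⋆`
passes it as well: the errors amount to at most `ε₀ / k` in the optimization and `2 ε₀ / k` in the
selection, and the tolerances of sets of different sizes differ by at least `ε₀ / k` and `5 ε₀ / k`
(`tolerance_add_le`). The selection succeeds because `I⋆` passes its test. As the searches return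
sets of least size, they return endogenous sets, exactly and not just approximately. Thus a
refinement step keeps the stage endogenous and adds one-step policies that are `16 ε₀`-optimal under
the roll-in distribution (`refineStage_spec`).

By reachability the uniform mixture of a cover `Ψ^(t)` visits each endogenous state at least
`1 / (2 S^k)` times as often as any policy does, so these one-step policies lose at most
`2 S^k · 16 ε₀ = ε / H` under the roll-in distribution of an arbitrary policy (`occ_switch_le`).
Summing over the layers yields an `ε`-approximate cover.

The estimates are empirical means of `w · 1_E` with `w = A |Ψ^(t+1,h)| ≤ A S^k` and `w P(E) ≤ 1`. A
Bernstein-type bound with variance proxy `w` (`iid_deviation_le`) and a union bound over factor sets,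
target values and one-step policies (`expect_not_accurate_le`, `union_bound_le`) show that each of
the at most `H` steps fails with probability at most `δ / H`.
-/

noncomputable section

namespace ExoRL

variable {d S A H : ℕ}

/-! ### Factor sets and policy classes -/

lemma ActsOn.mono {π : OneStep d S A} {I J : Finset (Fin d)} (h : ActsOn π I) (hIJ : I ⊆ J) :
    ActsOn π J := fun s s' hs => h s s' <| by
  funext i
  exact congrFun hs ⟨i.1, hIJ i.2⟩

lemma restrict_eq_of_subset {I J : Finset (Fin d)} (hIJ : I ⊆ J) {s s' : State d S}
    (hs : J.restrict s = J.restrict s') : I.restrict s = I.restrict s' := by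
  funext i
  exact congrFun hs ⟨i.1, hIJ i.2⟩

lemma mem_factorSets {k : ℕ} {I₀ I : Finset (Fin d)} :
    I ∈ factorSets k I₀ ↔ I₀ ⊆ I ∧ I.card ≤ k := by
  simp [factorSets]

lemma mem_policiesOn {I : Finset (Fin d)} {π : OneStep d S A} :
    π ∈ policiesOn I ↔ ActsOn π I := by
  simp [policiesOn]

lemma mem_policiesUpTo {k : ℕ} {π : OneStep d S A} :
    π ∈ policiesUpTo k ↔ ∃ I : Finset (Fin d), I.card ≤ k ∧ ActsOn π I := by
  simp [policiesUpTo, mem_factorSets]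

lemma policiesOn_nonempty [NeZero A] (I : Finset (Fin d)) :
    (policiesOn I : Finset (OneStep d S A)).Nonempty :=
  ⟨fun _ => 0, mem_policiesOn.2 fun _ _ _ => rfl⟩

lemma policiesUpTo_nonempty [NeZero A] (k : ℕ) :
    (policiesUpTo k : Finset (OneStep d S A)).Nonempty :=
  ⟨fun _ => 0, mem_policiesUpTo.2 ⟨∅, by simp, fun _ _ _ => rfl⟩⟩

lemma le_policyMax {P : Finset (OneStep d S A)} (V : OneStep d S A → ℝ) {π : OneStep d S A}
    (hπ : π ∈ P) : V π ≤ policyMax P V :=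
  le_ciSup (f := fun π : {π // π ∈ P} => V π.1) (Set.finite_range _).bddAbove ⟨π, hπ⟩

lemma policyMax_le {P : Finset (OneStep d S A)} (hP : P.Nonempty) {V : OneStep d S A → ℝ} {b : ℝ}
    (h : ∀ π ∈ P, V π ≤ b) : policyMax P V ≤ b := by
  have : Nonempty {π // π ∈ P} := hP.to_subtype
  exact ciSup_le fun π => h π.1 π.2

lemma exists_eq_policyMax {P : Finset (OneStep d S A)} (hP : P.Nonempty)
    (V : OneStep d S A → ℝ) : ∃ π ∈ P, V π = policyMax P V := by
  obtain ⟨π, hπ, h⟩ := P.exists_max_image V hP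
  exact ⟨π, hπ, le_antisymm (le_policyMax V hπ) (policyMax_le hP h)⟩

/-! ### Tolerances -/

lemma tolerance_nonneg (k k' : ℕ) {ε : ℝ} (hε : 0 ≤ ε) : 0 ≤ tolerance k ε k' := by
  unfold tolerance; positivity

lemma tolerance_le (k k' : ℕ) {ε : ℝ} (hε : 0 ≤ ε) : tolerance k ε k' ≤ 3 * ε := by
  unfold tolerance
  refine mul_le_mul_of_nonneg_right ?_ hε
  have h1 : (1 : ℝ) ≤ 1 + 1 / (k : ℝ) := by
    have : (0 : ℝ) ≤ 1 / (k : ℝ) := by positivity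
    linarith
  refine (pow_le_pow_right₀ h1 (Nat.sub_le k k')).trans ?_
  rcases Nat.eq_zero_or_pos k with rfl | hk
  · norm_num
  · have hk' : (k : ℝ) ≠ 0 := by positivity
    have h2 : (1 + 1 / (k : ℝ)) ^ k ≤ Real.exp (1 / (k : ℝ)) ^ k := by
      refine pow_le_pow_left₀ (by positivity) ?_ k
      have := Real.add_one_le_exp (1 / (k : ℝ))
      linarith
    rw [← Real.exp_nat_mul, mul_one_div_cancel hk'] at h2
    exact h2.trans (by linarith [Real.exp_one_lt_d9])

/-- The gap between the tolerances of two sizes. It is what makes the bottom-up searches prefer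
the endogenous part of a factor set over the set itself. -/
lemma tolerance_add_le {k m m' : ℕ} {ε : ℝ} (hε : 0 ≤ ε) (hm : m' < m) (hk : m ≤ k) :
    tolerance k ε m + ε / k ≤ tolerance k ε m' := by
  unfold tolerance
  have h0 : (0 : ℝ) ≤ 1 / (k : ℝ) := by positivity
  have h1 : (1 : ℝ) ≤ 1 + 1 / (k : ℝ) := by linarith
  have h2 : (1 + 1 / (k : ℝ)) ^ (k - m + 1) ≤ (1 + 1 / (k : ℝ)) ^ (k - m') :=
    pow_le_pow_right₀ h1 (by omega)
  have h3 : (1 : ℝ) ≤ (1 + 1 / (k : ℝ)) ^ (k - m) := one_le_pow₀ h1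
  have h4 : (1 + 1 / (k : ℝ)) ^ (k - m) + 1 / k ≤ (1 + 1 / (k : ℝ)) ^ (k - m') := by
    refine le_trans ?_ h2
    rw [pow_succ]
    nlinarith
  calc _ = ((1 + 1 / (k : ℝ)) ^ (k - m) + 1 / k) * ε := by ring
    _ ≤ _ := mul_le_mul_of_nonneg_right h4 hε

/-! ### The bottom-up searches -/

/-- The bottom-up search succeeds as soon as some set satisfies the condition, and it returns a
set of least cardinality among those that do. -/
lemma factorSearch_spec (tie : TieBreak d S A) {k : ℕ} {I₀ : Finset (Fin d)}
    {cond : Finset (Fin d) → Prop} (h : ∃ I ∈ factorSets k I₀, cond I) :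
    ∃ I ∈ factorSets k I₀, factorSearch tie k I₀ cond = some I ∧ cond I ∧
      ∀ J ∈ factorSets k I₀, cond J → I.card ≤ J.card := by
  classical
  set hits := (factorSets k I₀).filter cond with hhits
  set least := hits.filter fun I => ∀ J ∈ hits, I.card ≤ J.card with hleast
  have hne : least.Nonempty := by
    obtain ⟨I, hI, hc⟩ := h
    obtain ⟨J, hJ, hmin⟩ := hits.exists_min_image Finset.card
      ⟨I, Finset.mem_filter.2 ⟨hI, hc⟩⟩
    exact ⟨J, Finset.mem_filter.2 ⟨hJ, hmin⟩⟩
  have hmem := tie.factor_mem least hne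
  obtain ⟨h1, h2⟩ := Finset.mem_filter.1 hmem
  obtain ⟨h3, h4⟩ := Finset.mem_filter.1 h1
  refine ⟨tie.factor least, h3, ?_, h4, fun J hJ hc => h2 J (Finset.mem_filter.2 ⟨hJ, hc⟩)⟩
  unfold factorSearch
  have e1 : (factorSets k I₀).filter cond = hits := rfl
  convert if_pos hne

/-- The optimization subroutine never fails. If the value estimates `Vhat` are accurate for
a function `V` on which every policy is dominated by one that ignores the exogenous part of its
factors, the resulting policy is endogenous and nearly optimal for `Vhat`. -/
theorem endoPolicyOptimization_spec [NeZero A] (tie : TieBreak d S A) {k : ℕ} {ε : ℝ} (hε : 0 ≤ ε)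
    {Istar : Finset (Fin d)} {Vhat V : OneStep d S A → ℝ}
    (herr : ∀ π ∈ policiesUpTo k, |Vhat π - V π| ≤ ε / (2 * k))
    (hrestrict : ∀ J π, ActsOn π J → ∃ π', ActsOn π' (J ∩ Istar) ∧ V π ≤ V π') :
    ∃ π, endoPolicyOptimization tie k ε Vhat = some π ∧ π ∈ policiesUpTo k ∧ ActsOn π Istar ∧
      ∀ π' ∈ policiesUpTo k, Vhat π' ≤ Vhat π + 3 * ε := by
  classical
  have hex : ∃ I ∈ factorSets (d := d) k ∅,
      policyMax (policiesUpTo k) Vhat ≤ policyMax (policiesOn I) Vhat + tolerance k ε I.card := by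
    obtain ⟨π, hπ, hmax⟩ := exists_eq_policyMax (policiesUpTo_nonempty k) Vhat
    obtain ⟨I, hI, hact⟩ := mem_policiesUpTo.1 hπ
    refine ⟨I, mem_factorSets.2 ⟨by simp, hI⟩, ?_⟩
    rw [← hmax]
    linarith [le_policyMax Vhat (mem_policiesOn.2 hact), tolerance_nonneg k I.card hε]
  obtain ⟨I, hI, hsome, hcond, hmin⟩ := factorSearch_spec tie hex
  have hIk : I.card ≤ k := (mem_factorSets.1 hI).2
  have hne : ((policiesOn I).filter fun π => ∀ π' ∈ policiesOn I, Vhat π' ≤ Vhat π).Nonempty := by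
    obtain ⟨π, hπ, h⟩ := (policiesOn I).exists_max_image Vhat (policiesOn_nonempty I)
    exact ⟨π, Finset.mem_filter.2 ⟨hπ, h⟩⟩
  obtain ⟨hπ, hopt⟩ := Finset.mem_filter.1 (tie.policy_mem _ hne)
  set π := tie.policy ((policiesOn I).filter fun π => ∀ π' ∈ policiesOn I, Vhat π' ≤ Vhat π)
  have hact := mem_policiesOn.1 hπ
  have hsub : I ⊆ Istar := by
    by_contra hnot
    have hlt : (I ∩ Istar).card < I.card :=
      Finset.card_lt_card ⟨Finset.inter_subset_left, fun h => hnot fun i hi =>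
        (Finset.mem_inter.1 (h hi)).2⟩
    refine absurd (hmin (I ∩ Istar) (mem_factorSets.2 ⟨by simp, hlt.le.trans hIk⟩) ?_)
      (not_le.2 hlt)
    obtain ⟨π', hπ', hV⟩ := hrestrict I π hact
    have h1 := abs_le.1 (herr π (mem_policiesUpTo.2 ⟨I, hIk, hact⟩))
    have h2 := abs_le.1 (herr π' (mem_policiesUpTo.2 ⟨_, hlt.le.trans hIk, hπ'⟩))
    have h3 := le_policyMax Vhat (mem_policiesOn.2 hπ')
    have h4 : policyMax (policiesOn I) Vhat ≤ Vhat π := policyMax_le (policiesOn_nonempty I) hopt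
    have h5 := tolerance_add_le hε hlt hIk
    have h6 : ε / k = ε / (2 * k) + ε / (2 * k) := by
      rw [← add_div, ← two_mul, mul_div_mul_left _ _ two_ne_zero]
    linarith [h1.1, h1.2, h2.1, h2.2]
  refine ⟨π, ?_, mem_policiesUpTo.2 ⟨I, hIk, hact⟩, hact.mono hsub, fun π' hπ' => ?_⟩
  · unfold endoPolicyOptimization
    rw [hsome]
    simp only [Option.map_some, π]
  · have h4 : policyMax (policiesOn I) Vhat ≤ Vhat π := policyMax_le (policiesOn_nonempty I) hopt
    linarith [le_policyMax Vhat hπ', tolerance_le k I.card hε]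

/-- The properties of a stage `x` that the backward steps preserve: its factors are endogenous, its
policies are endogenous, and they depend on the target state through these factors only. -/
structure Stage.IsEndo (Istar : Finset (Fin d)) (x : Stage d S A H) : Prop where
  subset : x.factors ⊆ Istar
  congr : ∀ s s', x.factors.restrict s = x.factors.restrict s' → x.ψ s = x.ψ s'
  endo : ∀ s, IsEndogenous Istar (x.ψ s)

lemma estimate_congr {N : ℕ} (D : Fin N → Sample d S A H) (Ψ : Finset (Policy d S A H))
    {I : Finset (Fin d)} {s s' : State d S} (hs : I.restrict s = I.restrict s') :
    estimate D Ψ I s = estimate D Ψ I s' := by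
  funext π ψ
  simp only [estimate, hs]

/-- The selection subroutine succeeds on accurate estimates and returns a set of endogenous
factors. -/
theorem endoFactorSelection_spec [NeZero A] (tie : TieBreak d S A) {k : ℕ} {ε : ℝ} (hε : 0 ≤ ε)
    {Istar I₀ : Finset (Fin d)} (hk : Istar.card ≤ k) (hI₀ : I₀ ⊆ Istar)
    (ψ : State d S → Policy d S A H) (pol : Finset (Fin d) → State d S → OneStep d S A)
    (dhat : Finset (Fin d) → State d S → OneStep d S A → Policy d S A H → ℝ)
    (V : Finset (Fin d) → State d S → OneStep d S A → ℝ)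
    (herr : ∀ I ∈ factorSets k I₀, ∀ s, ∀ π ∈ policiesUpTo k,
      |dhat I s π (ψ s) - V I s π| ≤ ε / (2 * k))
    (hrestrict : ∀ I ∈ factorSets k I₀, ∀ s J π, ActsOn π J →
      ∃ π', ActsOn π' (J ∩ Istar) ∧ V I s π ≤ V I s π')
    (hfactor : ∀ I ∈ factorSets k I₀, ∀ s, ∃ p : ℝ, 0 ≤ p ∧ p ≤ 1 ∧
      ∀ π, ActsOn π Istar → V I s π = p * V (I ∩ Istar) s π)
    (hpolmem : ∀ I ∈ factorSets k I₀, ∀ s, pol I s ∈ policiesUpTo k)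
    (hpol : ∀ I ∈ factorSets k I₀, ∀ s, ActsOn (pol I s) Istar)
    (hopt : ∀ I ∈ factorSets k I₀, ∀ s, ∀ π ∈ policiesUpTo k,
      dhat I s π (ψ s) ≤ dhat I s (pol I s) (ψ s) + 3 * ε) :
    ∃ I ∈ factorSets k I₀, endoFactorSelection tie k ε I₀ ψ pol dhat = some I ∧ I ⊆ Istar ∧
      ∀ s, ∀ π ∈ policiesUpTo k, V Istar s π ≤ V Istar s (pol I s) + 16 * ε := by
  classical
  have hτ0 : (0 : ℝ) ≤ ε / (2 * k) := by positivity
  have hτ : ε / (2 * k) ≤ ε / 2 := by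
    rcases Nat.eq_zero_or_pos k with rfl | hk
    · simp; positivity
    · have : (1 : ℝ) ≤ k := by exact_mod_cast hk
      exact div_le_div_of_nonneg_left hε (by norm_num) (by linarith)
  have hstar : Istar ∈ factorSets k I₀ := mem_factorSets.2 ⟨hI₀, hk⟩
  have hint : ∀ {I J : Finset (Fin d)}, J ∈ factorSets k I₀ → I₀ ⊆ I → J ∩ I ∈ factorSets k I₀ :=
    fun {I J} hJ hI => mem_factorSets.2 ⟨Finset.subset_inter (mem_factorSets.1 hJ).1 hI,
      (Finset.card_le_card Finset.inter_subset_left).trans (mem_factorSets.1 hJ).2⟩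
  -- Near-optimality for the endogenous part of a target transfers to the whole target.
  have key : ∀ J ∈ factorSets k I₀, ∀ s, ∀ π₀ ∈ policiesUpTo k, ActsOn π₀ Istar → ∀ b, 0 ≤ b →
      (∀ π ∈ policiesUpTo k,
        dhat (J ∩ Istar) s π (ψ s) ≤ dhat (J ∩ Istar) s π₀ (ψ s) + b) →
      policyMax (policiesUpTo k) (fun π => dhat J s π (ψ s)) ≤
        dhat J s π₀ (ψ s) + (b + 4 * (ε / (2 * k))) := by
    intro J hJ s π₀ hπ₀ hact b hb h
    refine policyMax_le (policiesUpTo_nonempty k) fun π hπ => ?_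
    obtain ⟨K, hK, hπK⟩ := mem_policiesUpTo.1 hπ
    obtain ⟨π', hπ', hV⟩ := hrestrict J hJ s K π hπK
    have hπ'm : π' ∈ policiesUpTo k := mem_policiesUpTo.2
      ⟨_, (Finset.card_le_card Finset.inter_subset_left).trans hK, hπ'⟩
    obtain ⟨p, hp0, hp1, hp⟩ := hfactor J hJ s
    have e1 := hp π' (hπ'.mono Finset.inter_subset_right)
    have e2 := hp π₀ hact
    have h1 := abs_le.1 (herr J hJ s π hπ)
    have h2 := abs_le.1 (herr J hJ s π₀ hπ₀)
    have hJ' := hint hJ hI₀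
    have h3 := abs_le.1 (herr _ hJ' s π' hπ'm)
    have h4 := abs_le.1 (herr _ hJ' s π₀ hπ₀)
    have h5 := h π' hπ'm
    have h6 : V (J ∩ Istar) s π' - V (J ∩ Istar) s π₀ ≤ b + 2 * (ε / (2 * k)) := by
      linarith [h3.1, h3.2, h4.1, h4.2]
    have h7 : p * (V (J ∩ Istar) s π' - V (J ∩ Istar) s π₀) ≤ b + 2 * (ε / (2 * k)) := by
      nlinarith
    linarith [h1.1, h1.2, h2.1, h2.2]
  have hex : ∃ I ∈ factorSets k I₀, ∀ J ∈ factorSets k I₀, ∀ s : State d S,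
      policyMax (policiesUpTo k) (fun π => dhat J s π (ψ s)) ≤
        dhat J s (pol (J ∩ I) s) (ψ s) + tolerance k (5 * ε) I.card := by
    refine ⟨Istar, hstar, fun J hJ s => ?_⟩
    have hJ' := hint hJ hI₀
    refine (key J hJ s _ (hpolmem _ hJ' s) (hpol _ hJ' s) (3 * ε) (by positivity)
      (hopt _ hJ' s)).trans ?_
    have h1 : 5 * ε ≤ tolerance k (5 * ε) Istar.card := by
      unfold tolerance
      refine le_mul_of_one_le_left (by positivity) (one_le_pow₀ ?_)
      have : (0 : ℝ) ≤ 1 / (k : ℝ) := by positivity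
      linarith
    linarith
  obtain ⟨I, hI, hsome, hcond, hmin⟩ := factorSearch_spec tie hex
  have hI' := mem_factorSets.1 hI
  have hsub : I ⊆ Istar := by
    by_contra hnot
    have hlt : (I ∩ Istar).card < I.card :=
      Finset.card_lt_card ⟨Finset.inter_subset_left, fun h => hnot fun i hi =>
        (Finset.mem_inter.1 (h hi)).2⟩
    refine absurd (hmin (I ∩ Istar) (hint hI hI₀) fun J hJ s => ?_) (not_le.2 hlt)
    have hJ' := hint hJ hI₀
    have e : J ∩ Istar ∩ I = J ∩ (I ∩ Istar) := by
      ext i; simp only [Finset.mem_inter]; tauto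
    have hm : J ∩ (I ∩ Istar) ∈ factorSets k I₀ :=
      hint hJ (Finset.subset_inter hI'.1 hI₀)
    have h1 := hcond _ hJ' s
    rw [e] at h1
    refine (key J hJ s _ (hpolmem _ hm s) (hpol _ hm s) _
      (tolerance_nonneg k I.card (by positivity : 0 ≤ 5 * ε))
      fun π hπ => (le_policyMax (fun π => dhat (J ∩ Istar) s π (ψ s)) hπ).trans h1).trans ?_
    have h2 := tolerance_add_le (by positivity : 0 ≤ 5 * ε) hlt hI'.2
    have h6 : 5 * ε / k = 10 * (ε / (2 * k)) := by
      rw [show (10 : ℝ) * (ε / (2 * k)) = (2 * (5 * ε)) / (2 * k) by ring,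
        mul_div_mul_left _ _ two_ne_zero]
    linarith
  refine ⟨I, hI, hsome, hsub, fun s π hπ => ?_⟩
  have h1 := hcond _ hstar s
  rw [Finset.inter_eq_right.2 hsub] at h1
  have h2 := le_policyMax (fun π => dhat Istar s π (ψ s)) hπ
  have h3 := tolerance_le k I.card (by positivity : 0 ≤ 5 * ε)
  have h4 := abs_le.1 (herr _ hstar s π hπ)
  have h5 := abs_le.1 (herr _ hstar s _ (hpolmem I hI s))
  linarith [h4.1, h4.2, h5.1, h5.2]

/-- One refinement step on accurate estimates: it succeeds, preserves the invariants, and the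
one-step policies it adds are nearly optimal for the targets on all endogenous factors. -/
theorem refineStage_spec [NeZero A] (tie : TieBreak d S A) {k : ℕ} {ε : ℝ} (hε : 0 ≤ ε)
    {Istar : Finset (Fin d)} (hk : Istar.card ≤ k) (t : Fin H) {N : ℕ}
    (D : Fin N → Sample d S A H) {x : Stage d S A H} (hx : x.IsEndo Istar)
    (V : Finset (Fin d) → State d S → OneStep d S A → ℝ)
    (herr : ∀ I ∈ factorSets k x.factors, ∀ s, ∀ π ∈ policiesUpTo k,
      |estimate D x.policies I s π (x.ψ s) - V I s π| ≤ ε / (2 * k))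
    (hrestrict : ∀ I ∈ factorSets k x.factors, ∀ s J π, ActsOn π J →
      ∃ π', ActsOn π' (J ∩ Istar) ∧ V I s π ≤ V I s π')
    (hfactor : ∀ I ∈ factorSets k x.factors, ∀ s, ∃ p : ℝ, 0 ≤ p ∧ p ≤ 1 ∧
      ∀ π, ActsOn π Istar → V I s π = p * V (I ∩ Istar) s π) :
    ∃ x', refineStage tie k ε t D x = some x' ∧ x'.IsEndo Istar ∧
      ∃ pol : State d S → OneStep d S A, (∀ s, ActsOn (pol s) Istar) ∧
        (∀ s, x'.ψ s = compose t idlePolicy (pol s) (x.ψ s)) ∧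
        ∀ s, ∀ π ∈ policiesUpTo k, V Istar s π ≤ V Istar s (pol s) + 16 * ε := by
  classical
  set dhat := estimate D x.policies with hdhat
  set opt := fun (I : Finset (Fin d)) (s : State d S) =>
      endoPolicyOptimization tie k ε fun π => dhat I s π (x.ψ s) with hoptdef
  have hspec : ∀ I ∈ factorSets k x.factors, ∀ s, ∃ π, opt I s = some π ∧ π ∈ policiesUpTo k ∧
      ActsOn π Istar ∧ ∀ π' ∈ policiesUpTo k, dhat I s π' (x.ψ s) ≤ dhat I s π (x.ψ s) + 3 * ε :=
    fun I hI s => endoPolicyOptimization_spec tie hε (herr I hI s) (hrestrict I hI s)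
  have hall : ∀ I ∈ factorSets k x.factors, ∀ s, (opt I s).isSome := fun I hI s => by
    obtain ⟨π, h, -⟩ := hspec I hI s
    simp [h]
  set pol := fun (I : Finset (Fin d)) (s : State d S) => (opt I s).getD fun _ => 0 with hpoldef
  have hp : ∀ I ∈ factorSets k x.factors, ∀ s, pol I s ∈ policiesUpTo k ∧
      ActsOn (pol I s) Istar ∧
      ∀ π' ∈ policiesUpTo k, dhat I s π' (x.ψ s) ≤ dhat I s (pol I s) (x.ψ s) + 3 * ε := by
    intro I hI s
    obtain ⟨π, h, h'⟩ := hspec I hI s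
    have : pol I s = π := by simp [hpoldef, h]
    rwa [this]
  obtain ⟨I, hI, hsome, hsub, hV⟩ := endoFactorSelection_spec tie hε hk hx.subset x.ψ pol dhat V
    herr hrestrict hfactor (fun I hI s => (hp I hI s).1) (fun I hI s => (hp I hI s).2.1)
    (fun I hI s => (hp I hI s).2.2)
  refine ⟨{ factors := I, ψ := fun s => compose t idlePolicy (pol I s) (x.ψ s) }, ?_, ?_,
    pol I, fun s => (hp I hI s).2.1, fun s => rfl, hV⟩
  · unfold refineStage
    refine (if_pos hall).trans ?_
    change Option.map _ (endoFactorSelection tie k ε x.factors x.ψ pol dhat) = _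
    rw [hsome]
    rfl
  · refine ⟨hsub, fun s s' hs => ?_, fun s i => ?_⟩
    · have h1 : x.ψ s = x.ψ s' :=
        hx.congr s s' (restrict_eq_of_subset (mem_factorSets.1 hI).1 hs)
      have h2 : pol I s = pol I s' := by
        simp only [hpoldef, hoptdef, hdhat, h1, estimate_congr D x.policies hs]
      simp only [h1, h2]
    · simp only [compose]
      split_ifs with h1 h2
      · exact fun _ _ _ => rfl
      · exact (hp I hI s).2.1
      · exact hx.endo s i

/-! ### Expectations over finite types -/

/-- The expectation of a real function under a distribution on a finite type. -/
def expect {α : Type*} [Fintype α] (p : PMF α) (f : α → ℝ) : ℝ := ∑ a, (p a).toReal * f a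

section expect
variable {α β : Type*} [Fintype α] [Fintype β]

lemma sum_toReal (p : PMF α) : ∑ a, (p a).toReal = 1 := by
  rw [← ENNReal.toReal_sum fun a _ => p.apply_ne_top a]
  have h1 : ∑ a, p a = 1 := (tsum_fintype (L := .unconditional α) _).symm.trans p.tsum_coe
  simp [h1]

lemma expect_const (p : PMF α) (c : ℝ) : expect p (fun _ => c) = c := by
  simp [expect, ← Finset.sum_mul, sum_toReal]

lemma expect_mono (p : PMF α) {f g : α → ℝ} (h : ∀ a, f a ≤ g a) : expect p f ≤ expect p g :=
  Finset.sum_le_sum fun a _ => mul_le_mul_of_nonneg_left (h a) ENNReal.toReal_nonneg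

lemma expect_nonneg (p : PMF α) {f : α → ℝ} (h : ∀ a, 0 ≤ f a) : 0 ≤ expect p f :=
  Finset.sum_nonneg fun a _ => mul_nonneg ENNReal.toReal_nonneg (h a)

lemma expect_add (p : PMF α) (f g : α → ℝ) :
    expect p (fun a => f a + g a) = expect p f + expect p g := by
  simp [expect, mul_add, Finset.sum_add_distrib]

lemma expect_const_mul (p : PMF α) (c : ℝ) (f : α → ℝ) :
    expect p (fun a => c * f a) = c * expect p f := by
  simp only [expect, Finset.mul_sum]
  exact Finset.sum_congr rfl fun a _ => by ring

lemma expect_sum {ι : Type*} (p : PMF α) (s : Finset ι) (f : ι → α → ℝ) :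
    expect p (fun a => ∑ i ∈ s, f i a) = ∑ i ∈ s, expect p (f i) := by
  simp only [expect, Finset.mul_sum]
  exact Finset.sum_comm

lemma expect_pure (a : α) (f : α → ℝ) : expect (PMF.pure a) f = f a := by
  classical
  simp [expect, PMF.pure_apply, apply_ite ENNReal.toReal]

lemma expect_bind (p : PMF α) (q : α → PMF β) (f : β → ℝ) :
    expect (p.bind q) f = expect p fun a => expect (q a) f := by
  simp only [expect, PMF.bind_apply, tsum_fintype, Finset.mul_sum]
  rw [Finset.sum_comm]
  refine Finset.sum_congr rfl fun b _ => ?_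
  rw [ENNReal.toReal_sum fun a _ => ENNReal.mul_ne_top (p.apply_ne_top a) ((q a).apply_ne_top b),
    Finset.sum_mul]
  exact Finset.sum_congr rfl fun a _ => by rw [ENNReal.toReal_mul]; ring

lemma expect_map (p : PMF α) (g : α → β) (f : β → ℝ) :
    expect (p.map g) f = expect p (f ∘ g) := by
  rw [← PMF.bind_pure_comp, expect_bind]
  congr 1
  funext a
  exact expect_pure _ _

lemma toReal_apply_eq_expect [DecidableEq α] (p : PMF α) (a : α) :
    (p a).toReal = expect p fun b => if b = a then 1 else 0 := by
  simp [expect]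

open Classical in
lemma toOuterMeasure_eq_expect (p : PMF α) (s : Set α) :
    p.toOuterMeasure s = ENNReal.ofReal (expect p fun a => if a ∈ s then 1 else 0) := by
  rw [PMF.toOuterMeasure_apply_fintype, expect, ENNReal.ofReal_sum_of_nonneg]
  · refine Finset.sum_congr rfl fun a _ => ?_
    by_cases h : a ∈ s <;> simp [h, ENNReal.ofReal_toReal, p.apply_ne_top]
  · intro a _
    split_ifs <;> simp

lemma expect_uniformOfFinset (s : Finset α) (hs : s.Nonempty) (f : α → ℝ) :
    expect (PMF.uniformOfFinset s hs) f = (1 / (s.card : ℝ)) * ∑ a ∈ s, f a := by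
  classical
  simp only [expect, PMF.uniformOfFinset_apply, Finset.mul_sum]
  rw [← Finset.sum_subset (Finset.subset_univ s)]
  · refine Finset.sum_congr rfl fun a ha => ?_
    simp [ha]
  · intro a _ ha
    simp [ha]

end expect

/-! ### A Bernstein-type bound for importance-weighted frequencies -/

section concentration
variable {α : Type} [Fintype α]

lemma iid_apply_toReal (p : PMF α) (N : ℕ) (x : Fin N → α) :
    (iid p N x).toReal = ∏ n, (p (x n)).toReal := by
  simp [iid, ENNReal.toReal_prod]

lemma expect_iid_prod (p : PMF α) (N : ℕ) (g : α → ℝ) :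
    expect (iid p N) (fun x => ∏ n, g (x n)) = expect p g ^ N := by
  classical
  have h := Finset.prod_univ_sum (fun _ : Fin N => (Finset.univ : Finset α))
    (fun _ a => (p a).toReal * g a)
  rw [Fintype.piFinset_univ] at h
  simp only [expect, iid_apply_toReal, ← Finset.prod_mul_distrib]
  rw [← h]
  simp

/-- The exponential moment of `w · 1_E`, where the weight `w` is at most `1 / P(E)`. The variance
proxy is `w` rather than `w ^ 2`. -/
lemma expect_exp_le (p : PMF α) (E : α → Prop) [DecidablePred E] {w c : ℝ} (hw : 0 < w)
    (hwE : w * expect p (fun a => if E a then 1 else 0) ≤ 1) (hc : |c * w| ≤ 1) :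
    expect p (fun a => Real.exp (c * ((if E a then w else 0) -
      w * expect p (fun a => if E a then 1 else 0)))) ≤ Real.exp (c ^ 2 * w) := by
  set q := expect p (fun a => if E a then 1 else 0) with hq
  have hq0 : 0 ≤ q := expect_nonneg p fun a => by split_ifs <;> norm_num
  have h1 : ∀ a, Real.exp (c * ((if E a then w else 0) - w * q)) =
      Real.exp (-(c * w * q)) * (1 + (Real.exp (c * w) - 1) * (if E a then 1 else 0)) := by
    intro a
    by_cases h : E a
    · simp only [h, if_true]
      rw [show c * (w - w * q) = -(c * w * q) + c * w by ring, Real.exp_add]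
      ring
    · simp only [h, if_false]
      rw [show c * (0 - w * q) = -(c * w * q) by ring]
      ring
  simp only [h1]
  rw [expect_const_mul, expect_add, expect_const, expect_const_mul, ← hq]
  have h2 := (abs_le.1 (Real.abs_exp_sub_one_sub_id_le hc)).2
  have h3 : 1 + (Real.exp (c * w) - 1) * q ≤ Real.exp ((Real.exp (c * w) - 1) * q) := by
    linarith [Real.add_one_le_exp ((Real.exp (c * w) - 1) * q)]
  refine (mul_le_mul_of_nonneg_left h3 (Real.exp_pos _).le).trans ?_
  rw [← Real.exp_add]
  refine Real.exp_le_exp.2 ?_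
  have h4 : (Real.exp (c * w) - 1 - c * w) * q ≤ (c * w) ^ 2 * q :=
    mul_le_mul_of_nonneg_right h2 hq0
  have h5 : c ^ 2 * w * (w * q) ≤ c ^ 2 * w * 1 :=
    mul_le_mul_of_nonneg_left hwE (by positivity)
  nlinarith

open Classical in
/-- The exponential Markov inequality for the deviations in the direction of the sign of `c`. -/
lemma iid_tail_le (p : PMF α) (E : α → Prop) {w c τ : ℝ} {N : ℕ} (hw : 0 < w)
    (hwE : w * expect p (fun a => if E a then 1 else 0) ≤ 1) (hc : |c * w| ≤ 1) :
    expect (iid p N) (fun x => if |c| * (N * τ) < c * (∑ n, ((if E (x n) then w else 0) -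
      w * expect p (fun a => if E a then 1 else 0))) then 1 else 0) ≤
      Real.exp (N * (c ^ 2 * w - |c| * τ)) := by
  set q := expect p (fun a => if E a then 1 else 0) with hq
  have h1 : ∀ x : Fin N → α, (if |c| * (N * τ) < c * (∑ n, ((if E (x n) then w else 0) - w * q))
      then (1 : ℝ) else 0) ≤
      Real.exp (-(|c| * (N * τ))) * ∏ n, Real.exp (c * ((if E (x n) then w else 0) - w * q)) := by
    intro x
    rw [← Real.exp_sum, ← Real.exp_add, ← Finset.mul_sum]
    split_ifs with h
    · exact Real.one_le_exp (by linarith)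
    · exact (Real.exp_pos _).le
  refine (expect_mono _ h1).trans ?_
  rw [expect_const_mul, expect_iid_prod p N
    (fun a => Real.exp (c * ((if E a then w else 0) - w * q)))]
  have h2 := expect_exp_le p E hw hwE hc
  rw [← hq] at h2
  have h3 := pow_le_pow_left₀ (expect_nonneg p fun a => (Real.exp_pos _).le) h2 N
  refine (mul_le_mul_of_nonneg_left h3 (Real.exp_pos _).le).trans (le_of_eq ?_)
  rw [← Real.exp_nat_mul, ← Real.exp_add]
  congr 1
  ring

open Classical in
/-- The empirical mean of `N` independent copies of `w · 1_E`, where `w ≤ 1 / P(E)`, deviates from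
its expectation by more than `τ` with probability at most `2 exp (-N τ² / (4 w))`. -/
theorem iid_deviation_le (p : PMF α) (E : α → Prop) {w τ : ℝ} {N : ℕ} (hN : 0 < N) (hw : 0 < w)
    (hwE : w * expect p (fun a => if E a then 1 else 0) ≤ 1) (hτ0 : 0 ≤ τ) (hτ : τ ≤ 2) :
    expect (iid p N) (fun x => if τ < |(1 / (N : ℝ)) * (∑ n, if E (x n) then w else 0) -
      w * expect p (fun a => if E a then 1 else 0)| then 1 else 0) ≤
      2 * Real.exp (-(N * τ ^ 2 / (4 * w))) := by
  set q := expect p (fun a => if E a then 1 else 0) with hq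
  rcases hτ0.eq_or_lt with rfl | hτ0
  · refine (expect_mono _ (g := fun _ => 1) fun x => by split_ifs <;> norm_num).trans ?_
    rw [expect_const]
    norm_num
  have hN' : (0 : ℝ) < N := by exact_mod_cast hN
  -- The optimal exponents are `± τ / (2 w)`.
  set c := τ / (2 * w) with hcdef
  have hc0 : 0 < c := by positivity
  have hcw : c * w = τ / 2 := by rw [hcdef]; field_simp
  have e : N * (c ^ 2 * w - c * τ) = -(N * τ ^ 2 / (4 * w)) := by
    rw [hcdef]; field_simp; ring
  have h1 := iid_tail_le (c := c) (τ := τ) (N := N) p E hw hwE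
    (by rw [hcw, abs_of_pos (by positivity)]; linarith)
  have h2 := iid_tail_le (c := -c) (τ := τ) (N := N) p E hw hwE
    (by rw [neg_mul, abs_neg, hcw, abs_of_pos (by positivity)]; linarith)
  rw [← hq] at h1 h2
  rw [abs_neg, neg_sq] at h2
  rw [abs_of_pos hc0, e] at h1 h2
  refine le_trans ?_ ((add_le_add h1 h2).trans (le_of_eq (by ring)))
  rw [← expect_add]
  refine expect_mono _ fun x => ?_
  set Y := ∑ n, (if E (x n) then w else 0) with hY
  have hsum : ∑ n, ((if E (x n) then w else 0) - w * q) = Y - N * (w * q) := by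
    rw [Finset.sum_sub_distrib]; simp [hY]
  rw [hsum]
  have hYN : (1 / (N : ℝ)) * Y - w * q = (Y - N * (w * q)) / N := by field_simp
  rw [hYN, abs_div, abs_of_pos hN']
  by_cases h : τ < |Y - N * (w * q)| / N
  · rw [if_pos h]
    rw [lt_div_iff₀ hN'] at h
    rcases lt_abs.1 h with h | h
    · rw [if_pos (mul_lt_mul_of_pos_left (by linarith) hc0)]
      split_ifs <;> norm_num
    · rw [if_pos (c := c * (N * τ) < -c * (Y - N * (w * q))) (by nlinarith)]
      split_ifs <;> norm_num
  · rw [if_neg h]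
    split_ifs <;> norm_num

end concentration

/-! ### Forward and backward evaluation of policies -/

/-- The one-step policy that `π` plays at the timestep with index `n`. Beyond the horizon it is an
arbitrary constant. -/
def act [NeZero A] (π : Policy d S A H) (n : ℕ) : OneStep d S A :=
  if hn : n < H then π ⟨n, hn⟩ else fun _ => 0

/-- The probability of each state after `n` transitions under the one-step policies `p`. -/
def occState (M : MDP d S A) (p : ℕ → OneStep d S A) : ℕ → State d S → ℝ
  | 0, s => (M.init s).toReal
  | n + 1, s' => ∑ s, occState M p n s * (M.trans s (p n s) s').toReal

/-- `valueFrom M p m t f s` is the expectation of `f` after `m` transitions, when the one-step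
policies `p t, p (t + 1), …` are played from the state `s` on. -/
def valueFrom (M : MDP d S A) (p : ℕ → OneStep d S A) :
    ℕ → ℕ → (State d S → ℝ) → State d S → ℝ
  | 0, _, f => f
  | m + 1, t, f => fun s => expect (M.trans s (p t s)) (valueFrom M p m (t + 1) f)

/-- The expectation of `f` after `m + 1` transitions from `s`, the first under the action `a` and
the others under `p t, p (t + 1), …`. -/
def qValue (M : MDP d S A) (p : ℕ → OneStep d S A) (m t : ℕ) (f : State d S → ℝ)
    (s : State d S) (a : Fin A) : ℝ :=
  expect (M.trans s a) (valueFrom M p m t f)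

lemma valueFrom_succ_last (M : MDP d S A) (p : ℕ → OneStep d S A) (m t : ℕ)
    (f : State d S → ℝ) :
    valueFrom M p (m + 1) t f =
      valueFrom M p m t fun s => expect (M.trans s (p (t + m) s)) f := by
  induction m generalizing t with
  | zero => rfl
  | succ m ih =>
    funext s
    rw [valueFrom, ih (t + 1), valueFrom]
    simp only [Nat.add_assoc, Nat.add_comm 1 m]

lemma valueFrom_congr (M : MDP d S A) {p p' : ℕ → OneStep d S A} (m t : ℕ)
    (f : State d S → ℝ) (h : ∀ n, t ≤ n → p n = p' n) :
    valueFrom M p m t f = valueFrom M p' m t f := by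
  induction m generalizing t with
  | zero => rfl
  | succ m ih =>
    funext s
    rw [valueFrom, valueFrom, h t le_rfl, ih (t + 1) fun n hn => h n (by omega)]

lemma occState_congr (M : MDP d S A) {p p' : ℕ → OneStep d S A} (n : ℕ)
    (h : ∀ i, i < n → p i = p' i) : occState M p n = occState M p' n := by
  induction n with
  | zero => rfl
  | succ n ih =>
    funext s
    simp only [occState, ih fun i hi => h i (by omega), h n (Nat.lt_succ_self n)]

lemma occState_nonneg (M : MDP d S A) (p : ℕ → OneStep d S A) (n : ℕ) (s : State d S) :
    0 ≤ occState M p n s := by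
  induction n generalizing s with
  | zero => exact ENNReal.toReal_nonneg
  | succ n ih => exact Finset.sum_nonneg fun s _ => mul_nonneg (ih s) ENNReal.toReal_nonneg

lemma valueFrom_le_one (M : MDP d S A) (p : ℕ → OneStep d S A) (m t : ℕ) {f : State d S → ℝ}
    (hf : ∀ s, f s ≤ 1) (s : State d S) : valueFrom M p m t f s ≤ 1 := by
  induction m generalizing t s with
  | zero => exact hf s
  | succ m ih => exact (expect_mono _ (ih (t + 1))).trans_eq (expect_const _ _)

lemma qValue_le_one (M : MDP d S A) (p : ℕ → OneStep d S A) (m t : ℕ) {f : State d S → ℝ}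
    (hf : ∀ s, f s ≤ 1) (s : State d S) (a : Fin A) : qValue M p m t f s a ≤ 1 :=
  (expect_mono _ (valueFrom_le_one M p m t hf)).trans_eq (expect_const _ _)

lemma occ_nonneg (M : MDP d S A) (h : Fin H) (I : Finset (Fin d)) (s : State d S)
    (π : Policy d S A H) : 0 ≤ occ M h I s π := ENNReal.toReal_nonneg

lemma occ_le_iSup (M : MDP d S A) (h : Fin H) (I : Finset (Fin d)) (s : State d S)
    (π : Policy d S A H) : occ M h I s π ≤ ⨆ π : Policy d S A H, occ M h I s π :=
  le_ciSup (f := fun π : Policy d S A H => occ M h I s π) (Set.finite_range _).bddAbove π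

/-- A policy cover dominates the occupancy of every policy, up to the factor `2 |Φ|`. By
reachability a set that covers up to `η / 2` covers up to a factor `2`. -/
lemma occ_le_of_cover {M : MDP d S A} {I : Finset (Fin d)} {η : ℝ} (hη : IsReachable H M I η) {t : Fin H}
    {Φ : Finset (Policy d S A H)} (hcover : IsEndoCover M I t (η / 2) Φ) (π : Policy d S A H)
    (s : State d S) : occ M t I s π ≤ 2 * ∑ φ ∈ Φ, occ M t I s φ := by
  obtain ⟨φ, hφ, h1⟩ := hcover.1 s
  have h2 := occ_le_iSup M t I s π
  have h3 : occ M t I s φ ≤ ∑ φ ∈ Φ, occ M t I s φ :=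
    Finset.single_le_sum (f := fun φ => occ M t I s φ) (fun φ _ => occ_nonneg M t I s φ) hφ
  have h4 := occ_nonneg M t I s φ
  rcases hη t s with h | h <;> linarith

section
variable [NeZero A]

lemma act_of_lt (π : Policy d S A H) {n : ℕ} (hn : n < H) : act π n = π ⟨n, hn⟩ :=
  dif_pos hn

lemma expect_episodeLaw_last (M : MDP d S A) (π : Policy d S A H) (n : ℕ) (hn : n < H)
    (f : State d S → ℝ) :
    expect (episodeLaw M π n hn) (fun τ => f (τ (Fin.last n))) =
      ∑ s, occState M (act π) n s * f s := by
  induction n generalizing f with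
  | zero => simp only [episodeLaw, expect_map]; rfl
  | succ n ih =>
    have h1 := ih (Nat.lt_of_succ_lt hn) fun s => expect (M.trans s (act π n s)) f
    simp only [episodeLaw, expect_bind, expect_map, Function.comp_def, Fin.snoc_last]
    simp only [act_of_lt π (Nat.lt_of_succ_lt hn)] at h1
    rw [h1]
    simp only [occState, expect, Finset.mul_sum, Finset.sum_mul]
    rw [Finset.sum_comm]
    refine Finset.sum_congr rfl fun s' _ => Finset.sum_congr rfl fun s _ => ?_
    rw [act_of_lt π (Nat.lt_of_succ_lt hn)]
    ring

lemma expect_episodeLaw_add (M : MDP d S A) (π : Policy d S A H) (t m : ℕ) (hn : t + m < H)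
    (u f : State d S → ℝ) :
    expect (episodeLaw M π (t + m) hn)
        (fun τ => u (τ ⟨t, by omega⟩) * f (τ (Fin.last (t + m)))) =
      ∑ s, occState M (act π) t s * (u s * valueFrom M (act π) m t f s) := by
  induction m generalizing f with
  | zero => exact expect_episodeLaw_last M π t hn fun s => u s * f s
  | succ m ih =>
    have hn' : t + m < H := by omega
    have h1 := ih hn' fun s => expect (M.trans s (act π (t + m) s)) f
    rw [valueFrom_succ_last, ← h1, act_of_lt π hn']
    refine (expect_bind _ _ _).trans ?_
    congr 1
    funext τ
    rw [expect_map, ← expect_const_mul]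
    congr 1
    funext s'
    have e1 := Fin.snoc_castSucc (α := fun _ => State d S) s' τ
      ⟨t, Nat.lt_succ_of_le (Nat.le_add_right t m)⟩
    have e2 := Fin.snoc_last (α := fun _ => State d S) s' τ
    exact congrArg₂ (fun a b => u a * f b) e1 e2

lemma expect_episodeLaw (M : MDP d S A) (π : Policy d S A H) {t n : ℕ} (ht : t ≤ n) (hn : n < H)
    (u f : State d S → ℝ) :
    expect (episodeLaw M π n hn)
        (fun τ => u (τ ⟨t, Nat.lt_succ_of_le ht⟩) * f (τ (Fin.last n))) =
      ∑ s, occState M (act π) t s * (u s * valueFrom M (act π) (n - t) t f s) := by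
  obtain ⟨m, rfl⟩ := Nat.exists_eq_add_of_le ht
  rw [expect_episodeLaw_add, Nat.add_sub_cancel_left]

lemma sum_occState (M : MDP d S A) (π : Policy d S A H) {n : ℕ} (hn : n < H) :
    ∑ s, occState M (act π) n s = 1 := by
  have := expect_episodeLaw_last M π n hn fun _ => 1
  rw [expect_const] at this
  simpa using this.symm

/-- The indicator function of `s'[I] = s[I]`. -/
def target (I : Finset (Fin d)) (s s' : State d S) : ℝ :=
  if I.restrict s' = I.restrict s then 1 else 0

lemma target_le_one (I : Finset (Fin d)) (s s' : State d S) : target I s s' ≤ 1 := by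
  unfold target; split_ifs <;> norm_num

lemma occ_eq_sum (M : MDP d S A) (h : Fin H) (I : Finset (Fin d)) (s : State d S)
    (π : Policy d S A H) {t : ℕ} (ht : t ≤ h) :
    occ M h I s π =
      ∑ s', occState M (act π) t s' * valueFrom M (act π) (h - t) t (target I s) s' := by
  have h1 := expect_episodeLaw M π ht h.isLt (fun _ => 1) (target I s)
  simp only [one_mul] at h1
  rw [← h1, occ, toReal_apply_eq_expect, expect_map]
  rfl

lemma occ_eq_sum_target (M : MDP d S A) (h : Fin H) (I : Finset (Fin d)) (s : State d S)
    (π : Policy d S A H) :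
    occ M h I s π = ∑ s', occState M (act π) h s' * target I s s' := by
  rw [occ_eq_sum M h I s π le_rfl, Nat.sub_self]
  rfl

/-- The policy that follows `π` at the timesteps with index less than `n` and `ψ` from then on. -/
def switch (n : ℕ) (π ψ : Policy d S A H) : Policy d S A H :=
  fun i => if (i : ℕ) < n then π i else ψ i

lemma act_switch (n : ℕ) (π ψ : Policy d S A H) (i : ℕ) :
    act (switch n π ψ) i = if i < n then act π i else act ψ i := by
  unfold act switch
  by_cases hi : i < H <;> simp [hi]

lemma act_compose (t : Fin H) (φ : Policy d S A H) (π : OneStep d S A) (ψ : Policy d S A H)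
    (i : ℕ) :
    act (compose t φ π ψ) i = if i < t then act φ i else if i = t then π else act ψ i := by
  unfold act compose
  by_cases hi : i < H
  · simp [hi, Fin.lt_def, Fin.ext_iff]
  · have := t.isLt
    simp [hi, show ¬ i < (t : ℕ) by omega, show i ≠ (t : ℕ) by omega]

lemma occ_eq_sum_qValue (M : MDP d S A) {h t : Fin H} (ht : t < h) (I : Finset (Fin d))
    (s : State d S) (π : Policy d S A H) :
    occ M h I s π = ∑ s', occState M (act π) t s' *
      qValue M (act π) (h - t - 1) (t + 1) (target I s) s' (act π t s') := by
  have ht' : (t : ℕ) < h := ht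
  rw [occ_eq_sum M h I s π ht'.le, show (h : ℕ) - t = (h - t - 1) + 1 by omega]
  rfl

end

/-! ### Product structure of exogenous Markov decision processes -/

section
variable {I : Finset (Fin d)}

/-- The state with factors `x` in `I` and factors `y` in the complement of `I`. -/
def glue (I : Finset (Fin d)) (x : I → Fin S) (y : (Iᶜ : Finset (Fin d)) → Fin S) : State d S :=
  fun i => if h : i ∈ I then x ⟨i, h⟩ else y ⟨i, Finset.mem_compl.2 h⟩

@[simp] lemma restrict_glue (x : I → Fin S) (y : (Iᶜ : Finset (Fin d)) → Fin S) :
    I.restrict (glue I x y) = x := by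
  funext i
  simp [glue]

@[simp] lemma restrict_compl_glue (x : I → Fin S) (y : (Iᶜ : Finset (Fin d)) → Fin S) :
    Iᶜ.restrict (glue I x y) = y := by
  funext i
  have := Finset.mem_compl.1 i.2
  simp [glue, this]

lemma glue_restrict (s : State d S) : glue I (I.restrict s) (Iᶜ.restrict s) = s := by
  funext i
  by_cases h : i ∈ I <;> simp [glue, h]

lemma sum_glue (F : State d S → ℝ) : ∑ s, F s = ∑ y, ∑ x, F (glue I x y) := by
  rw [← Fintype.sum_prod_type']
  refine Fintype.sum_equiv
    { toFun := fun s => (Iᶜ.restrict s, I.restrict s)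
      invFun := fun z => glue I z.2 z.1
      left_inv := fun s => glue_restrict s
      right_inv := fun z => by simp } _ _ fun s => ?_
  simp [glue_restrict]

lemma sum_mul_restrict (g : (I → Fin S) → ℝ) (k : ((Iᶜ : Finset (Fin d)) → Fin S) → ℝ) :
    ∑ s : State d S, g (I.restrict s) * k (Iᶜ.restrict s) = (∑ x, g x) * ∑ y, k y := by
  rw [sum_glue (I := I), Finset.sum_mul_sum, Finset.sum_comm]
  simp

section kernel
variable {M : MDP d S A} {Ten : (I → Fin S) → Fin A → PMF (I → Fin S)}
  {Tex : ((Iᶜ : Finset (Fin d)) → Fin S) → PMF ((Iᶜ : Finset (Fin d)) → Fin S)}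

lemma expect_trans_mul
    (hT : ∀ s a s', M.trans s a s' =
      Ten (I.restrict s) a (I.restrict s') * Tex (Iᶜ.restrict s) (Iᶜ.restrict s'))
    (g : (I → Fin S) → ℝ) (k : ((Iᶜ : Finset (Fin d)) → Fin S) → ℝ) (s : State d S) (a : Fin A) :
    expect (M.trans s a) (fun s' => g (I.restrict s') * k (Iᶜ.restrict s')) =
      expect (Ten (I.restrict s) a) g * expect (Tex (Iᶜ.restrict s)) k := by
  simp only [expect, hT, ENNReal.toReal_mul]
  rw [← sum_mul_restrict (fun x => (Ten (I.restrict s) a x).toReal * g x)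
    (fun y => (Tex (Iᶜ.restrict s) y).toReal * k y)]
  exact Finset.sum_congr rfl fun s' _ => by ring

end kernel

variable [NeZero A]

lemma ActsOn.exists_eq {π : OneStep d S A} (h : ActsOn π I) :
    ∃ P : (I → Fin S) → Fin A, ∀ s, π s = P (I.restrict s) := by
  have h1 : Function.FactorsThrough π (I.restrict : State d S → _) := fun s s' hs => h s s' hs
  obtain ⟨P, hP⟩ := (Function.factorsThrough_iff _).1 h1
  exact ⟨P, fun s => congrFun hP s⟩

lemma IsEndogenous.act {π : Policy d S A H} (h : IsEndogenous I π) (n : ℕ) :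
    ActsOn (act π n) I := by
  unfold ExoRL.act
  split_ifs with hn
  · exact h _
  · exact fun _ _ _ => rfl

section kernel
variable {M : MDP d S A} {Ten : (I → Fin S) → Fin A → PMF (I → Fin S)}
  {Tex : ((Iᶜ : Finset (Fin d)) → Fin S) → PMF ((Iᶜ : Finset (Fin d)) → Fin S)}
  {den : PMF (I → Fin S)} {dex : PMF ((Iᶜ : Finset (Fin d)) → Fin S)}

/-- The expectation of `k` after one transition of the exogenous factors. -/
def exoStep (Tex : ((Iᶜ : Finset (Fin d)) → Fin S) → PMF ((Iᶜ : Finset (Fin d)) → Fin S))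
    (k : ((Iᶜ : Finset (Fin d)) → Fin S) → ℝ) : ((Iᶜ : Finset (Fin d)) → Fin S) → ℝ :=
  fun y => expect (Tex y) k

lemma exoStep_iterate_one (m : ℕ) : (exoStep Tex)^[m] (fun _ => 1) = fun _ => 1 := by
  induction m with
  | zero => rfl
  | succ m ih =>
    rw [Function.iterate_succ_apply', ih]
    funext y
    exact expect_const _ _

/-- The value of a product function under an endogenous policy is a product function, whose
exogenous factor does not depend on the policy. -/
lemma exists_valueFrom_eq
    (hT : ∀ s a s', M.trans s a s' =
      Ten (I.restrict s) a (I.restrict s') * Tex (Iᶜ.restrict s) (Iᶜ.restrict s'))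
    {p : ℕ → OneStep d S A} (hp : ∀ n, ActsOn (p n) I) (g : (I → Fin S) → ℝ) (m t : ℕ) :
    ∃ G : (I → Fin S) → ℝ, ∀ (k : ((Iᶜ : Finset (Fin d)) → Fin S) → ℝ) s,
      valueFrom M p m t (fun s => g (I.restrict s) * k (Iᶜ.restrict s)) s =
        G (I.restrict s) * (exoStep Tex)^[m] k (Iᶜ.restrict s) := by
  induction m generalizing t with
  | zero => exact ⟨g, fun k s => rfl⟩
  | succ m ih =>
    obtain ⟨G, hG⟩ := ih (t + 1)
    obtain ⟨P, hP⟩ := (hp t).exists_eq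
    refine ⟨fun x => expect (Ten x (P x)) G, fun k s => ?_⟩
    rw [Function.iterate_succ_apply']
    refine Eq.trans ?_ (expect_trans_mul hT G ((exoStep Tex)^[m] k) s (P (I.restrict s)))
    rw [← hP]
    exact congrArg _ (funext (hG k))

/-- The law of the exogenous factors after `n` transitions. -/
def exoLaw (Tex : ((Iᶜ : Finset (Fin d)) → Fin S) → PMF ((Iᶜ : Finset (Fin d)) → Fin S))
    (dex : PMF ((Iᶜ : Finset (Fin d)) → Fin S)) : ℕ → PMF ((Iᶜ : Finset (Fin d)) → Fin S)
  | 0 => dex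
  | n + 1 => (exoLaw Tex dex n).bind Tex

/-- Under an endogenous policy the endogenous and the exogenous factors are independent, and the
law of the latter does not depend on the policy. -/
lemma exists_occState_eq
    (hT : ∀ s a s', M.trans s a s' =
      Ten (I.restrict s) a (I.restrict s') * Tex (Iᶜ.restrict s) (Iᶜ.restrict s'))
    (hinit : ∀ s, M.init s = den (I.restrict s) * dex (Iᶜ.restrict s))
    {p : ℕ → OneStep d S A} (hp : ∀ n, ActsOn (p n) I) (n : ℕ) :
    ∃ F : (I → Fin S) → ℝ, ∀ s,
      occState M p n s = F (I.restrict s) * (exoLaw Tex dex n (Iᶜ.restrict s)).toReal := by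
  induction n with
  | zero => exact ⟨fun x => (den x).toReal, fun s => by
      simp [occState, hinit, exoLaw, ENNReal.toReal_mul]⟩
  | succ n ih =>
    obtain ⟨F, hF⟩ := ih
    obtain ⟨P, hP⟩ := (hp n).exists_eq
    refine ⟨fun x' => ∑ x, F x * (Ten x (P x) x').toReal, fun s' => ?_⟩
    have h1 : (exoLaw Tex dex (n + 1) (Iᶜ.restrict s')).toReal =
        ∑ y, (exoLaw Tex dex n y).toReal * (Tex y (Iᶜ.restrict s')).toReal := by
      rw [exoLaw, PMF.bind_apply, tsum_fintype, ENNReal.toReal_sum fun a _ =>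
        ENNReal.mul_ne_top (PMF.apply_ne_top _ _) (PMF.apply_ne_top _ _)]
      simp only [ENNReal.toReal_mul]
    rw [h1, ← sum_mul_restrict (fun x => F x * (Ten x (P x) (I.restrict s')).toReal)]
    simp only [occState, hF, hT, hP, ENNReal.toReal_mul]
    exact Finset.sum_congr rfl fun s _ => by ring

end kernel

open Classical in
/-- The indicator function of agreement with `s` on those factors in `K` that belong to `J`. -/
def partTarget (K J : Finset (Fin d)) (s : State d S) (x : K → Fin S) : ℝ :=
  if ∀ i : K, i.1 ∈ J → x i = s i.1 then 1 else 0

lemma target_eq_mul (J : Finset (Fin d)) (s s' : State d S) :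
    target J s s' =
      partTarget I J s (I.restrict s') * partTarget Iᶜ J s (Iᶜ.restrict s') := by
  have h : J.restrict s' = J.restrict s ↔
      (∀ i : I, i.1 ∈ J → I.restrict s' i = s i.1) ∧
        ∀ i : (Iᶜ : Finset (Fin d)), i.1 ∈ J → Iᶜ.restrict s' i = s i.1 := by
    simp only [funext_iff, Finset.restrict, Subtype.forall, Finset.mem_compl]
    exact ⟨fun h => ⟨fun a _ ha => h a ha, fun a _ ha => h a ha⟩, fun h a ha => by
      by_cases hI : a ∈ I
      · exact h.1 a hI ha
      · exact h.2 a hI ha⟩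
  unfold target partTarget
  simp only [h]
  rw [ite_and, ite_mul, one_mul, zero_mul]

lemma partTarget_inter (J : Finset (Fin d)) (s : State d S) :
    partTarget I (J ∩ I) s = partTarget I J s := by
  funext x
  simp [partTarget]

lemma partTarget_compl_inter (J : Finset (Fin d)) (s : State d S) :
    partTarget Iᶜ (J ∩ I) s = fun _ => 1 := by
  funext x
  refine if_pos fun i hi => absurd (Finset.mem_inter.1 hi).2 (Finset.mem_compl.1 i.2)

/-- The occupancy of the uniform mixture of the policies in `Φ`. -/
def mixOcc (M : MDP d S A) (Φ : Finset (Policy d S A H)) (n : ℕ) (s : State d S) : ℝ :=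
  (1 / (Φ.card : ℝ)) * ∑ φ ∈ Φ, occState M (act φ) n s

/-- The probability that `s_h[I] = s[I]` when a uniformly drawn member of `Φ` is followed before
layer `t`, the one-step policy `π` is played at layer `t`, and `ψ` is followed afterwards. -/
def mixValue (M : MDP d S A) (h t : Fin H) (Φ : Finset (Policy d S A H)) (ψ : Policy d S A H)
    (I : Finset (Fin d)) (s : State d S) (π : OneStep d S A) : ℝ :=
  ∑ s', mixOcc M Φ t s' * qValue M (act ψ) (h - t - 1) (t + 1) (target I s) s' (π s')

lemma mixOcc_nonneg (M : MDP d S A) (Φ : Finset (Policy d S A H)) (n : ℕ) (s : State d S) :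
    0 ≤ mixOcc M Φ n s :=
  mul_nonneg (by positivity) (Finset.sum_nonneg fun _ _ => occState_nonneg _ _ _ _)

lemma sum_mixOcc (M : MDP d S A) {Φ : Finset (Policy d S A H)} (hΦ : Φ.Nonempty) {n : ℕ}
    (hn : n < H) : ∑ s, mixOcc M Φ n s = 1 := by
  have hc : (Φ.card : ℝ) ≠ 0 := by exact_mod_cast hΦ.card_pos.ne'
  simp only [mixOcc, ← Finset.mul_sum]
  rw [Finset.sum_comm]
  simp [sum_occState M _ hn, hc]

lemma mixValue_le_one (M : MDP d S A) (h t : Fin H) {Φ : Finset (Policy d S A H)}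
    (hΦ : Φ.Nonempty) (ψ : Policy d S A H) (I : Finset (Fin d)) (s : State d S)
    (π : OneStep d S A) : mixValue M h t Φ ψ I s π ≤ 1 := by
  rw [← sum_mixOcc M hΦ t.isLt]
  exact Finset.sum_le_sum fun s' _ => mul_le_of_le_one_right (mixOcc_nonneg M Φ t s')
    (qValue_le_one _ _ _ _ (target_le_one I s) _ _)

/-- For endogenous roll-in and roll-out, the value of a one-step policy is a mixture over the
exogenous factors `y` of the endogenous values `∑ x, W x (π (glue x y))`. Passing from the target
`s[J]` to its endogenous part changes the weights `b` only, which then become a probability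
vector. -/
lemma exists_mixValue_eq {M : MDP d S A} (hM : IsExoMDP M I) (h t : Fin H)
    {Φ : Finset (Policy d S A H)} (hΦ : ∀ φ ∈ Φ, IsEndogenous I φ) {ψ : Policy d S A H}
    (hψ : IsEndogenous I ψ) (J : Finset (Fin d)) (s : State d S) :
    ∃ (W : (I → Fin S) → Fin A → ℝ) (b b' : ((Iᶜ : Finset (Fin d)) → Fin S) → ℝ),
      (∀ y, 0 ≤ b y ∧ b y ≤ b' y) ∧ ∑ y, b' y = 1 ∧
      (∀ π, mixValue M h t Φ ψ J s π = ∑ y, b y * ∑ x, W x (π (glue I x y))) ∧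
      ∀ π, mixValue M h t Φ ψ (J ∩ I) s π = ∑ y, b' y * ∑ x, W x (π (glue I x y)) := by
  obtain ⟨Ten, Tex, -, den, dex, hT, -, hinit⟩ := hM
  have hF := fun φ : Φ => exists_occState_eq hT hinit (hΦ φ.1 φ.2).act t
  choose F hF using hF
  obtain ⟨G, hG⟩ := exists_valueFrom_eq hT hψ.act (partTarget I J s) (h - t - 1) (t + 1)
  set op := exoStep Tex
  set m := (h : ℕ) - t - 1
  have hmix : ∀ s', mixOcc M Φ t s' = ((1 / (Φ.card : ℝ)) * ∑ φ : Φ, F φ (I.restrict s')) *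
      (exoLaw Tex dex t (Iᶜ.restrict s')).toReal := by
    intro s'
    rw [mixOcc, ← Finset.sum_coe_sort, mul_assoc, Finset.sum_mul]
    simp only [hF]
  have hval : ∀ (J' : Finset (Fin d)) (k : ((Iᶜ : Finset (Fin d)) → Fin S) → ℝ),
      (∀ s', target J' s s' = partTarget I J s (I.restrict s') * k (Iᶜ.restrict s')) →
      ∀ π, mixValue M h t Φ ψ J' s π =
        ∑ y, (exoLaw Tex dex t y).toReal * op^[m + 1] k y *
          ∑ x, ((1 / (Φ.card : ℝ)) * ∑ φ : Φ, F φ x) *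
            expect (Ten x (π (glue I x y))) G := by
    intro J' k hk π
    have hq : ∀ s' a, qValue M (act ψ) m (t + 1) (target J' s) s' a =
        expect (Ten (I.restrict s') a) G * op^[m + 1] k (Iᶜ.restrict s') := by
      intro s' a
      rw [Function.iterate_succ_apply']
      refine Eq.trans ?_ (expect_trans_mul hT G (op^[m] k) s' a)
      rw [qValue]
      congr 1
      funext s''
      rw [← hG k s'']
      congr 1
      funext z
      exact hk z
    rw [mixValue, sum_glue (I := I)]
    refine Finset.sum_congr rfl fun y _ => ?_
    rw [Finset.mul_sum]
    refine Finset.sum_congr rfl fun x _ => ?_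
    rw [hmix, hq, restrict_glue, restrict_compl_glue]
    ring
  have hk : ∀ m y, 0 ≤ op^[m] (partTarget Iᶜ J s) y ∧ op^[m] (partTarget Iᶜ J s) y ≤ 1 := by
    intro m
    induction m with
    | zero =>
      intro y
      simp only [Function.iterate_zero, id_eq, partTarget]
      split_ifs <;> norm_num
    | succ m ih =>
      intro y
      rw [Function.iterate_succ_apply']
      exact ⟨expect_nonneg _ fun z => (ih z).1,
        (expect_mono _ fun z => (ih z).2).trans_eq (expect_const _ _)⟩
  refine ⟨fun x a => ((1 / (Φ.card : ℝ)) * ∑ φ : Φ, F φ x) * expect (Ten x a) G,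
    fun y => (exoLaw Tex dex t y).toReal * op^[m + 1] (partTarget Iᶜ J s) y,
    fun y => (exoLaw Tex dex t y).toReal * op^[m + 1] (fun _ => 1) y, fun y => ⟨?_, ?_⟩, ?_,
    hval J _ fun s' => target_eq_mul J s s', hval (J ∩ I) _ fun s' => ?_⟩
  · exact mul_nonneg ENNReal.toReal_nonneg (hk _ y).1
  · rw [exoStep_iterate_one]
    exact mul_le_mul_of_nonneg_left (hk _ y).2 ENNReal.toReal_nonneg
  · simp only [op, exoStep_iterate_one, mul_one]
    exact sum_toReal _
  · rw [target_eq_mul (I := I) (J ∩ I), partTarget_inter, partTarget_compl_inter]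

/-- Fixing the exogenous factors at their most favourable value shows that a one-step policy on `K`
is dominated by one on `K ∩ I`. -/
lemma mixValue_restrict {M : MDP d S A} (hM : IsExoMDP M I) (hS : 1 ≤ S) (h t : Fin H)
    {Φ : Finset (Policy d S A H)} (hΦ : ∀ φ ∈ Φ, IsEndogenous I φ) {ψ : Policy d S A H}
    (hψ : IsEndogenous I ψ) (J : Finset (Fin d)) (s : State d S) {K : Finset (Fin d)}
    {π : OneStep d S A} (hπ : ActsOn π K) :
    ∃ π', ActsOn π' (K ∩ I) ∧ mixValue M h t Φ ψ J s π ≤ mixValue M h t Φ ψ J s π' := by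
  have : NeZero S := ⟨by omega⟩
  obtain ⟨W, b, b', hb, -, hV, -⟩ := exists_mixValue_eq hM h t hΦ hψ J s
  obtain ⟨y₀, -, hy₀⟩ := Finset.exists_max_image Finset.univ
    (fun y : (Iᶜ : Finset (Fin d)) → Fin S => ∑ x, W x (π (glue I x y))) Finset.univ_nonempty
  refine ⟨fun s => π (glue I (I.restrict s) y₀), fun s s' hs => hπ _ _ ?_, ?_⟩
  · funext i
    by_cases hi : i.1 ∈ I
    · have := congrFun hs ⟨i.1, Finset.mem_inter.2 ⟨i.2, hi⟩⟩
      simpa [glue, hi] using this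
    · simp [glue, hi]
  · rw [hV, hV]
    refine Finset.sum_le_sum fun y _ => mul_le_mul_of_nonneg_left ?_ (hb y).1
    simpa using hy₀ y (Finset.mem_univ y)

lemma mixValue_factor {M : MDP d S A} (hM : IsExoMDP M I) (h t : Fin H)
    {Φ : Finset (Policy d S A H)} (hΦ : ∀ φ ∈ Φ, IsEndogenous I φ) {ψ : Policy d S A H}
    (hψ : IsEndogenous I ψ) (J : Finset (Fin d)) (s : State d S) :
    ∃ p : ℝ, 0 ≤ p ∧ p ≤ 1 ∧ ∀ π, ActsOn π I →
      mixValue M h t Φ ψ J s π = p * mixValue M h t Φ ψ (J ∩ I) s π := by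
  obtain ⟨W, b, b', hb, hb', hV, hV'⟩ := exists_mixValue_eq hM h t hΦ hψ J s
  refine ⟨∑ y, b y, Finset.sum_nonneg fun y _ => (hb y).1,
    hb' ▸ Finset.sum_le_sum fun y _ => (hb y).2, fun π hπ => ?_⟩
  obtain ⟨P, hP⟩ := hπ.exists_eq
  rw [hV, hV']
  simp only [hP, restrict_glue, ← Finset.sum_mul]
  rw [hb', one_mul]

/-- Under an endogenous policy, the value of a target on the endogenous factors depends on the
endogenous factors of the current state only. -/
lemma exists_qValue_eq {M : MDP d S A} (hM : IsExoMDP M I) {ψ : Policy d S A H}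
    (hψ : IsEndogenous I ψ) (m t : ℕ) (s : State d S) :
    ∃ Q : (I → Fin S) → Fin A → ℝ, ∀ s' a,
      qValue M (act ψ) m t (target I s) s' a = Q (I.restrict s') a := by
  obtain ⟨Ten, Tex, -, den, dex, hT, -, hinit⟩ := hM
  obtain ⟨G, hG⟩ := exists_valueFrom_eq hT hψ.act (partTarget I I s) m t
  refine ⟨fun x a => expect (Ten x a) G, fun s' a => ?_⟩
  have h1 := expect_trans_mul hT G (fun _ => 1) s' a
  rw [expect_const, mul_one] at h1
  refine Eq.trans ?_ h1
  rw [qValue]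
  congr 1
  funext s''
  have h2 := hG (fun _ => 1) s''
  rw [exoStep_iterate_one] at h2
  rw [← h2]
  congr 1
  funext z
  have h3 := partTarget_compl_inter (I := I) I s
  rw [Finset.inter_self] at h3
  rw [target_eq_mul (I := I), h3]

/-! ### Transfer of near-optimality from the policy cover to arbitrary policies -/

lemma sum_occState_restrict (M : MDP d S A) (t : Fin H) (π : Policy d S A H)
    (D : (I → Fin S) → ℝ) (y₀ : (Iᶜ : Finset (Fin d)) → Fin S) :
    ∑ s, occState M (act π) t s * D (I.restrict s) =
      ∑ x, occ M t I (glue I x y₀) π * D x := by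
  simp only [occ_eq_sum_target, Finset.sum_mul]
  rw [Finset.sum_comm]
  refine Finset.sum_congr rfl fun s _ => ?_
  simp [target]

/-- If `π₀` is nearly optimal at layer `t` under the roll-in distribution of a policy cover, then
it is nearly optimal at layer `t` under the roll-in distribution of every policy `π`. -/
lemma sum_qValue_le {M : MDP d S A} (hM : IsExoMDP M I) (hS : 1 ≤ S) {k : ℕ} {η : ℝ}
    (hη : IsReachable H M I η) {t : Fin H} {Φ : Finset (Policy d S A H)}
    (hcover : IsEndoCover M I t (η / 2) Φ) (hcard : Φ.card ≤ S ^ k) (h : Fin H)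
    {ψ : Policy d S A H} (hψ : IsEndogenous I ψ) (s : State d S) {π₀ : OneStep d S A}
    (hπ₀ : ActsOn π₀ I) {gap : ℝ}
    (hgap : ∀ π, ActsOn π I → mixValue M h t Φ ψ I s π ≤ mixValue M h t Φ ψ I s π₀ + gap)
    (π : Policy d S A H) (π₁ : OneStep d S A) :
    ∑ s', occState M (act π) t s' *
        qValue M (act ψ) (h - t - 1) (t + 1) (target I s) s' (π₁ s') ≤
      ∑ s', occState M (act π) t s' *
        qValue M (act ψ) (h - t - 1) (t + 1) (target I s) s' (π₀ s') + 2 * S ^ k * gap := by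
  have : NeZero S := ⟨by omega⟩
  have hΦ : Φ.Nonempty := by
    obtain ⟨φ, hφ, -⟩ := hcover.1 s
    exact ⟨φ, hφ⟩
  have hc : (0 : ℝ) < Φ.card := by exact_mod_cast hΦ.card_pos
  obtain ⟨Q, hQ⟩ := exists_qValue_eq hM hψ (h - t - 1) (t + 1) s
  obtain ⟨P₀, hP₀⟩ := hπ₀.exists_eq
  have hbest : ∀ x, ∃ a, ∀ a', Q x a' ≤ Q x a := fun x => by
    obtain ⟨a, -, ha⟩ := Finset.exists_max_image Finset.univ (Q x) Finset.univ_nonempty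
    exact ⟨a, fun a' => ha a' (Finset.mem_univ a')⟩
  choose P hP using hbest
  set D := fun x => Q x (P x) - Q x (P₀ x) with hD
  have hD0 : ∀ x, 0 ≤ D x := fun x => sub_nonneg.2 (hP x _)
  have y₀ : (Iᶜ : Finset (Fin d)) → Fin S := fun _ => 0
  have h1 : ∑ s', mixOcc M Φ t s' * D (I.restrict s') ≤ gap := by
    have := hgap (fun s => P (I.restrict s)) fun s s' hs => by simp only [hs]
    simp only [mixValue, hQ, hP₀] at this
    simp only [hD, mul_sub, Finset.sum_sub_distrib]
    linarith
  have h2 : ∑ s', mixOcc M Φ t s' * D (I.restrict s') =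
      (1 / (Φ.card : ℝ)) * ∑ x, (∑ φ ∈ Φ, occ M t I (glue I x y₀) φ) * D x := by
    simp only [mixOcc, Finset.sum_mul, mul_assoc, ← Finset.mul_sum]
    rw [Finset.sum_comm]
    simp only [sum_occState_restrict M t _ D y₀]
    rw [Finset.sum_comm]
  have h3 : ∑ s', occState M (act π) t s' * D (I.restrict s') ≤ 2 * S ^ k * gap := by
    rw [sum_occState_restrict M t π D y₀]
    have h4 : ∑ x, occ M t I (glue I x y₀) π * D x ≤
        2 * ∑ x, (∑ φ ∈ Φ, occ M t I (glue I x y₀) φ) * D x := by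
      rw [Finset.mul_sum]
      refine Finset.sum_le_sum fun x _ => ?_
      rw [← mul_assoc]
      exact mul_le_mul_of_nonneg_right (occ_le_of_cover hη hcover π _) (hD0 x)
    have h5 : ∑ x, (∑ φ ∈ Φ, occ M t I (glue I x y₀) φ) * D x =
        Φ.card * ∑ s', mixOcc M Φ t s' * D (I.restrict s') := by
      rw [h2]; field_simp
    have h6 : 0 ≤ ∑ s', mixOcc M Φ t s' * D (I.restrict s') :=
      Finset.sum_nonneg fun s' _ => mul_nonneg (mixOcc_nonneg M Φ t s') (hD0 _)
    have h7 : (Φ.card : ℝ) ≤ (S : ℝ) ^ k := by exact_mod_cast hcard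
    have h8 : (Φ.card : ℝ) * ∑ s', mixOcc M Φ t s' * D (I.restrict s') ≤ (S : ℝ) ^ k * gap :=
      mul_le_mul h7 h1 h6 (by positivity)
    rw [h5] at h4
    linarith
  refine le_trans ?_ (add_le_add_right h3 _)
  rw [← Finset.sum_add_distrib]
  refine Finset.sum_le_sum fun s' _ => ?_
  rw [← mul_add, hQ, hQ, hP₀]
  refine mul_le_mul_of_nonneg_left ?_ (occState_nonneg _ _ _ _)
  have := hP (I.restrict s') (π₁ s')
  simp only [hD]
  linarith

/-- The one-layer step of the performance difference argument. -/
lemma occ_switch_le {M : MDP d S A} (hM : IsExoMDP M I) (hS : 1 ≤ S) {k : ℕ} {η : ℝ}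
    (hη : IsReachable H M I η) {h t : Fin H} (ht : t < h) {Φ : Finset (Policy d S A H)}
    (hcover : IsEndoCover M I t (η / 2) Φ) (hcard : Φ.card ≤ S ^ k)
    {ψ : Policy d S A H} (hψ : IsEndogenous I ψ) (s : State d S) {π₀ : OneStep d S A}
    (hπ₀ : ActsOn π₀ I) {gap : ℝ}
    (hgap : ∀ π, ActsOn π I → mixValue M h t Φ ψ I s π ≤ mixValue M h t Φ ψ I s π₀ + gap)
    (π : Policy d S A H) :
    occ M h I s (switch (t + 1) π ψ) ≤
      occ M h I s (switch t π (compose t idlePolicy π₀ ψ)) + 2 * S ^ k * gap := by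
  rw [occ_eq_sum_qValue M ht, occ_eq_sum_qValue M ht]
  have e1 : occState M (act (switch (t + 1) π ψ)) t = occState M (act π) t :=
    occState_congr M t fun i hi => by rw [act_switch, if_pos (by omega)]
  have e2 : occState M (act (switch t π (compose t idlePolicy π₀ ψ))) t =
      occState M (act π) t :=
    occState_congr M t fun i hi => by rw [act_switch, if_pos hi]
  have e3 : valueFrom M (act (switch (t + 1) π ψ)) (h - t - 1) (t + 1) (target I s) =
      valueFrom M (act ψ) (h - t - 1) (t + 1) (target I s) :=
    valueFrom_congr M _ _ _ fun n hn => by rw [act_switch, if_neg (by omega)]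
  have e4 : valueFrom M (act (switch t π (compose t idlePolicy π₀ ψ))) (h - t - 1) (t + 1)
      (target I s) = valueFrom M (act ψ) (h - t - 1) (t + 1) (target I s) :=
    valueFrom_congr M _ _ _ fun n hn => by
      rw [act_switch, if_neg (by omega), act_compose, if_neg (by omega), if_neg (by omega)]
  have e5 : act (switch t π (compose t idlePolicy π₀ ψ)) t = π₀ := by
    rw [act_switch, if_neg (lt_irrefl _), act_compose, if_neg (lt_irrefl _), if_pos rfl]
  rw [e1, e2, e5]
  simp only [qValue, e3, e4]
  exact sum_qValue_le hM hS hη hcover hcard h hψ s hπ₀ hgap π _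

end

/-! ### The expectation of the importance-weighted estimates -/

/-- The event whose importance-weighted frequency is the estimate at `s[I]`, `π`, `ψ`. -/
def SampleEvent (I : Finset (Fin d)) (s : State d S) (π : OneStep d S A) (ψ : Policy d S A H)
    (z : Sample d S A H) : Prop :=
  z.2.1 = π z.1 ∧ z.2.2.1 = ψ ∧ I.restrict z.2.2.2 = I.restrict s

open Classical in
lemma estimate_eq {N : ℕ} (D : Fin N → Sample d S A H) (Ψ : Finset (Policy d S A H))
    (I : Finset (Fin d)) (s : State d S) (π : OneStep d S A) (ψ : Policy d S A H) :
    estimate D Ψ I s π ψ =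
      (1 / (N : ℝ)) * ∑ n, if SampleEvent I s π ψ (D n) then (A : ℝ) * Ψ.card else 0 := by
  unfold estimate
  congr 1
  refine Finset.sum_congr rfl fun n _ => ?_
  by_cases h : SampleEvent I s π ψ (D n)
  · rw [if_pos h, if_pos (show _ ∧ _ ∧ _ from h)]
    simp [mul_comm]
  · rw [if_neg h, if_neg (show ¬(_ ∧ _ ∧ _) from h)]
    simp

open Classical in
lemma expect_sampleEvent [NeZero A] (M : MDP d S A) {h t : Fin H} (ht : t < h)
    {Φ Ψ : Finset (Policy d S A H)} (hΦ : Φ.Nonempty) {ψ : Policy d S A H} (hψ : ψ ∈ Ψ)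
    (I : Finset (Fin d)) (s : State d S) (π : OneStep d S A) :
    ((A : ℝ) * Ψ.card) * expect (sampleLaw h (fun π => episodeLaw M π h h.isLt) t ht Φ Ψ)
      (fun z => if SampleEvent I s π ψ z then 1 else 0) = mixValue M h t Φ ψ I s π := by
  have hΨ : Ψ.Nonempty := ⟨ψ, hψ⟩
  have hc : (Ψ.card : ℝ) ≠ 0 := by exact_mod_cast hΨ.card_pos.ne'
  have hA : (A : ℝ) ≠ 0 := by exact_mod_cast NeZero.ne A
  have ht' : (t : ℕ) < h := ht
  have h1 : ∀ (φ ψ' : Policy d S A H) (a : Fin A),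
      expect ((episodeLaw M (compose t φ (fun _ => a) ψ') h h.isLt).map fun τ =>
          (τ ⟨t, Nat.lt_succ_of_lt ht⟩, a, ψ', τ (Fin.last h)))
        (fun z => if SampleEvent I s π ψ z then 1 else 0) =
      if ψ' = ψ then ∑ s', occState M (act φ) t s' * ((if a = π s' then 1 else 0) *
        qValue M (act ψ) (h - t - 1) (t + 1) (target I s) s' a) else 0 := by
    intro φ ψ' a
    rw [expect_map]
    split_ifs with hψ'
    · subst hψ'
      have h2 := expect_episodeLaw M (compose t φ (fun _ => a) ψ') ht'.le h.isLt
        (fun s' => if a = π s' then 1 else 0) (target I s)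
      have e1 : occState M (act (compose t φ (fun _ => a) ψ')) t = occState M (act φ) t :=
        occState_congr M t fun i hi => by rw [act_compose, if_pos hi]
      have e2 : valueFrom M (act (compose t φ (fun _ => a) ψ')) (h - t) t (target I s) =
          fun s' => qValue M (act ψ') (h - t - 1) (t + 1) (target I s) s' a := by
        obtain ⟨m, hm⟩ : ∃ m, (h : ℕ) - t = m + 1 := ⟨h - t - 1, by omega⟩
        rw [hm, Nat.add_sub_cancel]
        funext s'
        simp only [valueFrom]
        rw [act_compose, if_neg (lt_irrefl _), if_pos rfl, qValue]
        congr 1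
        exact valueFrom_congr M m (t + 1) (target I s) fun n hn => by
          rw [act_compose, if_neg (by omega), if_neg (by omega)]
      rw [e1, e2] at h2
      rw [← h2]
      congr 1
      funext τ
      simp only [Function.comp_def, SampleEvent, target, true_and]
      by_cases h3 : a = π (τ ⟨t, Nat.lt_succ_of_lt ht⟩) <;>
      by_cases h4 : I.restrict (τ (Fin.last h)) = I.restrict s <;>
      simp only [h3, h4, and_true, and_false, if_true, if_false, mul_one, mul_zero]
    · refine Eq.trans ?_ (expect_const (episodeLaw M (compose t φ (fun _ => a) ψ') h h.isLt) 0)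
      congr 1
      funext τ
      exact if_neg fun h3 : SampleEvent I s π ψ _ => hψ' h3.2.1
  simp only [sampleLaw, unif, dif_pos hΦ, dif_pos hΨ, PMF.uniformOfFintype, expect_bind,
    expect_uniformOfFinset, h1, Finset.sum_ite_eq', hψ, if_true]
  simp only [mixValue, mixOcc, Finset.card_univ, Fintype.card_fin]
  simp only [← Finset.mul_sum, Finset.sum_mul, mul_assoc]
  have h5 : ∀ s' (F : Fin A → ℝ), ∑ a, (if a = π s' then 1 else 0) * F a = F (π s') := by
    intro s' F
    simp
  have h6 : ∀ φ : Policy d S A H, ∑ a, ∑ s', occState M (act φ) t s' *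
      ((if a = π s' then 1 else 0) *
        qValue M (act ψ) (h - t - 1) (t + 1) (target I s) s' a) =
      ∑ s', occState M (act φ) t s' *
        qValue M (act ψ) (h - t - 1) (t + 1) (target I s) s' (π s') := by
    intro φ
    rw [Finset.sum_comm]
    refine Finset.sum_congr rfl fun s' _ => ?_
    rw [← Finset.mul_sum, h5]
  simp only [h6]
  rw [Finset.sum_comm]
  field_simp

/-! ### Uniform accuracy of the estimates -/

lemma card_factorSets_le (k : ℕ) (I₀ : Finset (Fin d)) :
    (factorSets k I₀).card ≤ (d + 1) ^ k := by
  classical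
  induction k generalizing I₀ with
  | zero =>
    rw [pow_zero, Finset.card_le_one]
    intro I hI J hJ
    have h1 := (mem_factorSets.1 hI).2
    have h2 := (mem_factorSets.1 hJ).2
    rw [Finset.card_eq_zero.1 (Nat.le_zero.1 h1), Finset.card_eq_zero.1 (Nat.le_zero.1 h2)]
  | succ k ih =>
    have hsub : factorSets (k + 1) I₀ ⊆
        (factorSets k ∅ ×ˢ (Finset.univ : Finset (Option (Fin d)))).image
          fun z => z.2.elim z.1 fun i => insert i z.1 := by
      intro I hI
      have h1 := (mem_factorSets.1 hI).2
      rcases I.eq_empty_or_nonempty with rfl | ⟨i, hi⟩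
      · exact Finset.mem_image.2 ⟨(∅, none), by simp [mem_factorSets], rfl⟩
      · refine Finset.mem_image.2 ⟨(I.erase i, some i), ?_, Finset.insert_erase hi⟩
        have h2 := Finset.card_erase_of_mem hi
        simp only [Finset.mem_product, Finset.mem_univ, and_true, mem_factorSets]
        exact ⟨by simp, by omega⟩
    refine (Finset.card_le_card hsub).trans (Finset.card_image_le.trans ?_)
    rw [Finset.card_product, Finset.card_univ, Fintype.card_option, Fintype.card_fin, pow_succ]
    exact Nat.mul_le_mul_right _ (ih ∅)

lemma card_policiesOn_le (hS : 1 ≤ S) (I : Finset (Fin d)) :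
    (policiesOn I : Finset (OneStep d S A)).card ≤ A ^ S ^ I.card := by
  have : NeZero S := ⟨by omega⟩
  have y₀ : (Iᶜ : Finset (Fin d)) → Fin S := fun _ => 0
  have h1 : (policiesOn I : Finset (OneStep d S A)).card ≤
      (Finset.univ : Finset ((I → Fin S) → Fin A)).card := by
    refine Finset.card_le_card_of_injOn (fun π v => π (glue I v y₀)) (fun _ _ => by simp) ?_
    intro π hπ π' hπ' h
    funext s
    rw [mem_policiesOn.1 hπ s (glue I (I.restrict s) y₀) (by simp),
      mem_policiesOn.1 hπ' s (glue I (I.restrict s) y₀) (by simp)]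
    exact congrFun h (I.restrict s)
  simpa using h1

lemma card_policiesUpTo_le (hS : 1 ≤ S) (hA : 1 ≤ A) (k : ℕ) :
    (policiesUpTo k : Finset (OneStep d S A)).card ≤ (d + 1) ^ k * A ^ S ^ k := by
  classical
  have hsub : (policiesUpTo k : Finset (OneStep d S A)) ⊆
      (factorSets k ∅).biUnion fun I => policiesOn I := by
    intro π hπ
    obtain ⟨I, hI, hact⟩ := mem_policiesUpTo.1 hπ
    exact Finset.mem_biUnion.2 ⟨I, mem_factorSets.2 ⟨by simp, hI⟩, mem_policiesOn.2 hact⟩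
  refine (Finset.card_le_card hsub).trans ?_
  refine (Finset.card_biUnion_le_card_mul _ _ (A ^ S ^ k) fun I hI => ?_).trans
    (Nat.mul_le_mul_right _ (card_factorSets_le k ∅))
  refine (card_policiesOn_le hS I).trans ?_
  exact Nat.pow_le_pow_right hA (Nat.pow_le_pow_right hS (mem_factorSets.1 hI).2)

lemma Stage.card_policies_le (hS : 1 ≤ S) {k : ℕ} {Istar : Finset (Fin d)} (hk : Istar.card ≤ k)
    {x : Stage d S A H} (hx : x.IsEndo Istar) : x.policies.card ≤ S ^ k := by
  classical
  have : NeZero S := ⟨by omega⟩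
  have y₀ : (x.factorsᶜ : Finset (Fin d)) → Fin S := fun _ => 0
  have hsub : x.policies ⊆
      (Finset.univ : Finset (x.factors → Fin S)).image fun v => x.ψ (glue x.factors v y₀) := by
    intro ψ hψ
    obtain ⟨s, -, rfl⟩ := Finset.mem_image.1 hψ
    exact Finset.mem_image.2 ⟨x.factors.restrict s, Finset.mem_univ _,
      hx.congr _ _ (by simp)⟩
  refine (Finset.card_le_card hsub).trans (Finset.card_image_le.trans ?_)
  rw [Finset.card_univ]
  simp only [Fintype.card_fun, Fintype.card_fin, Fintype.card_coe]
  exact Nat.pow_le_pow_right hS ((Finset.card_le_card hx.subset).trans hk)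

lemma Stage.mem_policies (x : Stage d S A H) (s : State d S) : x.ψ s ∈ x.policies :=
  Finset.mem_image.2 ⟨s, Finset.mem_univ s, rfl⟩

/-- All estimates that a refinement of the stage `x` looks at are within `τ` of their means. -/
def Accurate [NeZero A] (M : MDP d S A) (h t : Fin H) (k : ℕ) (Φ : Finset (Policy d S A H))
    (x : Stage d S A H) (τ : ℝ) {N : ℕ} (D : Fin N → Sample d S A H) : Prop :=
  ∀ I ∈ factorSets k x.factors, ∀ s, ∀ π ∈ policiesUpTo k,
    |estimate D x.policies I s π (x.ψ s) - mixValue M h t Φ (x.ψ s) I s π| ≤ τ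

open Classical in
/-- Union bound over the factor sets, the target values and the one-step policies. -/
theorem expect_not_accurate_le [NeZero A] (M : MDP d S A) (hS : 1 ≤ S) {h t : Fin H} (ht : t < h)
    {k : ℕ} {Istar : Finset (Fin d)} (hk : Istar.card ≤ k) {Φ : Finset (Policy d S A H)}
    (hΦ : Φ.Nonempty) {x : Stage d S A H} (hx : x.IsEndo Istar) {τ : ℝ} (hτ0 : 0 ≤ τ)
    (hτ : τ ≤ 2) {N : ℕ} (hN : 0 < N) :
    expect (iid (sampleLaw h (fun π => episodeLaw M π h h.isLt) t ht Φ x.policies) N)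
        (fun D => if ¬ Accurate M h t k Φ x τ D then 1 else 0) ≤
      (d + 1) ^ k * (S ^ k * ((d + 1) ^ k * A ^ S ^ k *
        (2 * Real.exp (-(N * τ ^ 2 / (4 * (A * S ^ k))))))) := by
  have : NeZero S := ⟨by omega⟩
  have hA : 0 < (A : ℝ) := by exact_mod_cast NeZero.pos A
  set p := sampleLaw h (fun π => episodeLaw M π h h.isLt) t ht Φ x.policies with hp
  set b := 2 * Real.exp (-(N * τ ^ 2 / (4 * (A * S ^ k)))) with hb
  have hb0 : 0 ≤ b := by positivity
  set rep := fun (I : Finset (Fin d)) (v : I → Fin S) => glue I v fun _ => 0 with hrep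
  set dev := fun (I : Finset (Fin d)) (s : State d S) (π : OneStep d S A)
      (D : Fin N → Sample d S A H) =>
    if τ < |estimate D x.policies I s π (x.ψ s) - mixValue M h t Φ (x.ψ s) I s π|
    then (1 : ℝ) else 0 with hdev
  have hdev0 : ∀ I s π D, 0 ≤ dev I s π D := fun I s π D => by
    simp only [hdev]; split_ifs <;> norm_num
  have hsingle : ∀ I s π, expect (iid p N) (dev I s π) ≤ b := by
    intro I s π
    have hmem := x.mem_policies s
    have hc : 0 < (x.policies.card : ℝ) := by exact_mod_cast Finset.card_pos.2 ⟨_, hmem⟩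
    have hcard : (x.policies.card : ℝ) ≤ (S : ℝ) ^ k := by
      exact_mod_cast x.card_policies_le hS hk hx
    have hmean := expect_sampleEvent M ht hΦ hmem I s π
    have h1 := iid_deviation_le (w := (A : ℝ) * x.policies.card) (τ := τ) (N := N) p
      (SampleEvent I s π (x.ψ s)) hN (by positivity)
      (by rw [hmean]; exact mixValue_le_one M h t hΦ _ _ _ _) hτ0 hτ
    rw [hmean] at h1
    have h2 : expect (iid p N) (dev I s π) ≤
        2 * Real.exp (-(N * τ ^ 2 / (4 * (A * x.policies.card)))) := by
      refine le_trans (le_of_eq ?_) h1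
      congr 1
      funext D
      simp only [hdev, estimate_eq]
    refine h2.trans ?_
    rw [hb]
    gcongr
  have hle : ∀ D, (if ¬ Accurate M h t k Φ x τ D then (1 : ℝ) else 0) ≤
      ∑ I ∈ factorSets k x.factors, ∑ v : I → Fin S,
        ∑ π ∈ (policiesUpTo k : Finset (OneStep d S A)), dev I (rep I v) π D := by
    intro D
    split_ifs with hacc
    · exact Finset.sum_nonneg fun I _ => Finset.sum_nonneg fun v _ =>
        Finset.sum_nonneg fun π _ => hdev0 _ _ _ _
    · simp only [Accurate, not_forall, not_le] at hacc
      obtain ⟨I, hI, s, π, hπ, hlt⟩ := hacc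
      -- The deviation depends on `s` through `s[I]` only.
      have hs : I.restrict s = I.restrict (rep I (I.restrict s)) := by simp [hrep]
      have e1 : x.ψ s = x.ψ (rep I (I.restrict s)) :=
        hx.congr _ _ (restrict_eq_of_subset (mem_factorSets.1 hI).1 hs)
      have e2 : target I s = target I (rep I (I.restrict s)) := by
        funext s'
        exact if_congr (by rw [← hs]) rfl rfl
      have e3 : dev I (rep I (I.restrict s)) π D = 1 := by
        simp only [hdev]
        rw [if_pos]
        rw [← e1, ← estimate_congr D x.policies hs, mixValue, ← e2]
        exact hlt
      calc (1 : ℝ) = dev I (rep I (I.restrict s)) π D := e3.symm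
        _ ≤ ∑ π ∈ (policiesUpTo k : Finset (OneStep d S A)), dev I (rep I (I.restrict s)) π D :=
          Finset.single_le_sum (f := fun π => dev I (rep I (I.restrict s)) π D)
            (fun π _ => hdev0 _ _ _ _) hπ
        _ ≤ ∑ v : I → Fin S, ∑ π ∈ (policiesUpTo k : Finset (OneStep d S A)),
              dev I (rep I v) π D :=
          Finset.single_le_sum (f := fun v : I → Fin S =>
            ∑ π ∈ (policiesUpTo k : Finset (OneStep d S A)), dev I (rep I v) π D)
            (fun v _ => Finset.sum_nonneg fun π _ => hdev0 _ _ _ _) (Finset.mem_univ _)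
        _ ≤ _ :=
          Finset.single_le_sum (f := fun I : Finset (Fin d) => ∑ v : I → Fin S,
            ∑ π ∈ (policiesUpTo k : Finset (OneStep d S A)), dev I (rep I v) π D)
            (fun I _ => Finset.sum_nonneg fun v _ => Finset.sum_nonneg fun π _ =>
              hdev0 _ _ _ _) hI
  refine (expect_mono _ hle).trans ?_
  rw [expect_sum]
  have c1 : ((factorSets k x.factors).card : ℝ) ≤ ((d : ℝ) + 1) ^ k := by
    exact_mod_cast card_factorSets_le k x.factors
  have c2 : ((policiesUpTo k : Finset (OneStep d S A)).card : ℝ) ≤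
      ((d : ℝ) + 1) ^ k * (A : ℝ) ^ S ^ k := by
    exact_mod_cast card_policiesUpTo_le hS (NeZero.pos A) k
  have hI : ∀ I ∈ factorSets k x.factors,
      expect (iid p N) (fun D => ∑ v : I → Fin S,
        ∑ π ∈ (policiesUpTo k : Finset (OneStep d S A)), dev I (rep I v) π D) ≤
      S ^ k * ((d + 1) ^ k * A ^ S ^ k * b) := by
    intro I hI
    rw [expect_sum]
    have hv : ∀ v : I → Fin S, expect (iid p N) (fun D =>
        ∑ π ∈ (policiesUpTo k : Finset (OneStep d S A)), dev I (rep I v) π D) ≤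
        (d + 1) ^ k * A ^ S ^ k * b := by
      intro v
      rw [expect_sum]
      refine (Finset.sum_le_card_nsmul _ _ b fun π _ => hsingle I (rep I v) π).trans ?_
      rw [nsmul_eq_mul]
      exact mul_le_mul_of_nonneg_right c2 hb0
    refine (Finset.sum_le_card_nsmul _ _ _ fun v _ => hv v).trans ?_
    rw [nsmul_eq_mul]
    refine mul_le_mul_of_nonneg_right ?_ (by positivity)
    have h3 : (Finset.univ : Finset (I → Fin S)).card ≤ S ^ k := by
      rw [Finset.card_univ]
      simp only [Fintype.card_fun, Fintype.card_fin, Fintype.card_coe]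
      exact Nat.pow_le_pow_right hS (mem_factorSets.1 hI).2
    exact_mod_cast h3
  refine (Finset.sum_le_card_nsmul _ _ _ hI).trans ?_
  rw [nsmul_eq_mul]
  exact mul_le_mul_of_nonneg_right c1 (by positivity)

/-! ### Sample size -/

/-- Lower bounds for `dSAH / δ`. They need a horizon of at least two, without which there are no
backward steps and the logarithm in the rate can be arbitrarily small. -/
lemma le_dsah_div {δ : ℝ} (hd : 1 ≤ d) (hS : 1 ≤ S) (hA : 1 ≤ A) (hH : 2 ≤ H)
    (hδ0 : 0 < δ) (hδ1 : δ < 1) :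
    2 ≤ (d : ℝ) * S * A * H / δ ∧ (d : ℝ) + 1 ≤ d * S * A * H / δ ∧
      (S : ℝ) ≤ d * S * A * H / δ ∧ (A : ℝ) ≤ d * S * A * H / δ ∧
      (H : ℝ) / δ ≤ d * S * A * H / δ := by
  have hd' : (1 : ℝ) ≤ d := by exact_mod_cast hd
  have hS' : (1 : ℝ) ≤ S := by exact_mod_cast hS
  have hA' : (1 : ℝ) ≤ A := by exact_mod_cast hA
  have hH' : (2 : ℝ) ≤ H := by exact_mod_cast hH
  have h1 : (d : ℝ) * S * A * H ≤ d * S * A * H / δ :=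
    le_div_self (by positivity) hδ0 hδ1.le
  have hdS : (1 : ℝ) ≤ d * S := one_le_mul_of_one_le_of_one_le hd' hS'
  have hdSA : (1 : ℝ) ≤ d * S * A := one_le_mul_of_one_le_of_one_le hdS hA'
  have hSA : (1 : ℝ) ≤ S * A := one_le_mul_of_one_le_of_one_le hS' hA'
  refine ⟨?_, ?_, ?_, ?_, ?_⟩
  · nlinarith
  · have : (d : ℝ) * 2 ≤ d * S * A * H := by
      rw [mul_assoc (d : ℝ) S A, mul_assoc]
      exact mul_le_mul_of_nonneg_left (by nlinarith) (by linarith)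
    linarith
  · have h2 : (S : ℝ) ≤ d * S := le_mul_of_one_le_left (by linarith) hd'
    have h3 : (d : ℝ) * S ≤ d * S * A := le_mul_of_one_le_right (by linarith) hA'
    have h4 : (d : ℝ) * S * A ≤ d * S * A * H := le_mul_of_one_le_right (by linarith) (by linarith)
    linarith
  · have h2 : (A : ℝ) ≤ d * S * A := le_mul_of_one_le_left (by linarith) hdS
    have h4 : (d : ℝ) * S * A ≤ d * S * A * H := le_mul_of_one_le_right (by linarith) (by linarith)
    linarith
  · exact div_le_div_of_nonneg_right (le_mul_of_one_le_left (by linarith) hdSA) hδ0.le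

lemma half_le_rate {k : ℕ} {ε δ : ℝ} (hd : 1 ≤ d) (hS : 1 ≤ S) (hA : 1 ≤ A) (hH : 2 ≤ H)
    (hk : 1 ≤ k) (hε0 : 0 < ε) (hε1 : ε ≤ 1) (hδ0 : 0 < δ) (hδ1 : δ < 1) :
    1 / 2 ≤ rate d S A H k ε δ := by
  have hX := (le_dsah_div hd hS hA hH hδ0 hδ1).1
  have hlog : 1 / 2 ≤ Real.log ((d : ℝ) * S * A * H / δ) := by
    have h1 := Real.log_le_log (by norm_num) hX
    linarith [Real.log_two_gt_d9]
  have hS' : (1 : ℝ) ≤ S := by exact_mod_cast hS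
  have hA' : (1 : ℝ) ≤ A := by exact_mod_cast hA
  have hH' : (1 : ℝ) ≤ H := by exact_mod_cast (by omega : 1 ≤ H)
  have hk' : (1 : ℝ) ≤ k := by exact_mod_cast hk
  have h1 : (1 : ℝ) ≤ A * (S : ℝ) ^ (4 * k) * (H : ℝ) ^ 2 * (k : ℝ) ^ 3 :=
    one_le_mul_of_one_le_of_one_le (one_le_mul_of_one_le_of_one_le
      (one_le_mul_of_one_le_of_one_le hA' (one_le_pow₀ hS')) (one_le_pow₀ hH')) (one_le_pow₀ hk')
  unfold rate
  rw [le_div_iff₀ (by positivity)]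
  have h2 : ε ^ 2 ≤ 1 := pow_le_one₀ hε0.le hε1
  nlinarith

/-- The sample size makes the union bound at most `δ / H`. With `Y = (dSAH / δ) ^ (k S^k)`, each of
the six quantities `(d + 1) ^ k` (twice), `S ^ k`, `A ^ (S ^ k)`, `2` and `H / δ` is at most `Y`. The
exponential is at most `Y ^ (-6)`, which is where the constant `98304 = 6 · 4 · 64 ^ 2` comes from:
the accuracy is `ε / (64 k S^k H)`. -/
lemma union_bound_le {k N : ℕ} {ε δ C : ℝ} (hd : 1 ≤ d) (hS : 1 ≤ S) (hA : 1 ≤ A) (hH : 2 ≤ H)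
    (hk : 1 ≤ k) (hε0 : 0 < ε) (hε1 : ε ≤ 1) (hδ0 : 0 < δ) (hδ1 : δ < 1) (hC : 98304 ≤ C)
    (hN : C * rate d S A H k ε δ ≤ N) :
    ((d : ℝ) + 1) ^ k * (S ^ k * ((d + 1) ^ k * A ^ S ^ k *
        (2 * Real.exp (-(N * (ε / (2 * (S : ℝ) ^ k * H) / 16 / (2 * k)) ^ 2 /
          (4 * (A * S ^ k))))))) ≤ δ / H := by
  obtain ⟨h2, hdX, hSX, hAX, hHX⟩ := le_dsah_div hd hS hA hH hδ0 hδ1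
  have hrate := half_le_rate hd hS hA hH hk hε0 hε1 hδ0 hδ1
  set X := (d : ℝ) * S * A * H / δ with hX
  have hX1 : 1 ≤ X := by linarith
  have hS0 : (0 : ℝ) < S := by exact_mod_cast hS
  have hA0 : (0 : ℝ) < A := by exact_mod_cast hA
  have hH0 : (0 : ℝ) < H := by exact_mod_cast (by omega : 0 < H)
  have hk0 : (0 : ℝ) < k := by exact_mod_cast hk
  set n := k * S ^ k with hn
  have hkn : k ≤ n := Nat.le_mul_of_pos_right k (Nat.pow_pos hS)
  have hSn : S ^ k ≤ n := Nat.le_mul_of_pos_left (S ^ k) hk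
  have hn1 : 1 ≤ n := hk.trans hkn
  have hpow : ∀ {a : ℝ} {m : ℕ}, 0 ≤ a → a ≤ X → m ≤ n → a ^ m ≤ X ^ n := fun ha haX hm =>
    (pow_le_pow_left₀ ha haX _).trans (pow_le_pow_right₀ hX1 hm)
  have hexp : Real.exp (-(N * (ε / (2 * (S : ℝ) ^ k * H) / 16 / (2 * k)) ^ 2 /
      (4 * (A * S ^ k)))) ≤ (X ^ n)⁻¹ ^ 6 := by
    have e : (X ^ n)⁻¹ ^ 6 = Real.exp (-(6 * n * Real.log X)) := by
      rw [Real.exp_neg, inv_pow, ← pow_mul, mul_comm n 6]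
      congr 1
      rw [show (6 * (n : ℝ)) = ((6 * n : ℕ) : ℝ) by push_cast; ring, Real.exp_nat_mul,
        Real.exp_log (by linarith)]
    rw [e]
    refine Real.exp_le_exp.2 (neg_le_neg ?_)
    have h4 : 98304 * rate d S A H k ε δ ≤ N :=
      (mul_le_mul_of_nonneg_right hC (by linarith)).trans hN
    have h5 : 6 * n * Real.log X = 98304 * rate d S A H k ε δ *
        (ε / (2 * (S : ℝ) ^ k * H) / 16 / (2 * k)) ^ 2 / (4 * (A * S ^ k)) := by
      rw [rate, ← hX, hn, pow_mul' (S : ℝ) 4 k]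
      push_cast
      field_simp
      ring
    rw [h5]
    gcongr
  have hY : 0 < X ^ n := by positivity
  have hd1 := hpow (by positivity) hdX hkn
  have hS1 := hpow hS0.le hSX hkn
  have hA1 := hpow hA0.le hAX hSn
  have h21 : (2 : ℝ) ≤ X ^ n := by simpa using hpow (m := 1) (by norm_num) h2 hn1
  have hH1 : (H : ℝ) / δ ≤ X ^ n := by simpa using hpow (m := 1) (by positivity) hHX hn1
  have hlast : (X ^ n)⁻¹ ≤ δ / H := by
    rw [← inv_div]
    exact inv_anti₀ (by positivity) hH1
  refine le_trans ?_ hlast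
  calc _ ≤ X ^ n * (X ^ n * (X ^ n * X ^ n * (X ^ n * (X ^ n)⁻¹ ^ 6))) := by gcongr
    _ = (X ^ n)⁻¹ := by field_simp

/-! ### The backward induction -/

/-- The invariant of the backward steps: before the step at the layer with index `n - 1`, following
`ψ^(n,h)_s` from the layer with index `n` on loses at most `ε / H` for each of these layers. -/
structure Stage.IsGood [NeZero A] (M : MDP d S A) (h : Fin H) (Istar : Finset (Fin d)) (ε : ℝ)
    (n : ℕ) (x : Stage d S A H) : Prop where
  isEndo : x.IsEndo Istar
  occ_le : ∀ s π, occ M h Istar s π ≤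
    occ M h Istar s (switch n π (x.ψ s)) + ((h : ℝ) - n) * (ε / H)

lemma occ_switch_self [NeZero A] (M : MDP d S A) (h : Fin H) (I : Finset (Fin d)) (s : State d S)
    (π ψ : Policy d S A H) : occ M h I s (switch h π ψ) = occ M h I s π := by
  rw [occ_eq_sum_target, occ_eq_sum_target, occState_congr M h fun i hi => by
    rw [act_switch, if_pos hi]]

/-- With no factors there is only one target, and it is always attained. -/
lemma occ_empty [NeZero A] (M : MDP d S A) (h : Fin H) (s : State d S) (π : Policy d S A H) :
    occ M h ∅ s π = 1 := by
  have h1 : ∀ s', target ∅ s s' = 1 := fun s' => if_pos (Subsingleton.elim _ _)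
  rw [occ_eq_sum_target]
  simp only [h1, mul_one]
  exact sum_occState M π h.isLt

section
variable [NeZero A] {M : MDP d S A} {Istar : Finset (Fin d)} {h : Fin H} {ε : ℝ} {k : ℕ}

theorem Stage.IsGood.refine (hM : IsExoMDP M Istar) (hS : 1 ≤ S) (hk : Istar.card ≤ k) {η : ℝ}
    (hη : IsReachable H M Istar η) (hε : 0 < ε) (tie : TieBreak d S A) {t : Fin H} (ht : t < h)
    {Φ : Finset (Policy d S A H)} (hcover : IsEndoCover M Istar t (η / 2) Φ)
    (hcard : Φ.card ≤ S ^ k) {x : Stage d S A H} (hx : x.IsGood M h Istar ε (t + 1)) {N : ℕ}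
    {D : Fin N → Sample d S A H}
    (hD : Accurate M h t k Φ x (ε / (2 * (S : ℝ) ^ k * H) / 16 / (2 * k)) D) :
    ∃ x', refineStage tie k (ε / (2 * (S : ℝ) ^ k * H) / 16) t D x = some x' ∧
      x'.IsGood M h Istar ε t := by
  have hS0 : (0 : ℝ) < S := by exact_mod_cast hS
  have hH0 : (0 : ℝ) < H := by exact_mod_cast Fin.pos t
  obtain ⟨x', hsome, hendo, pol, hpol, hψ, hopt⟩ := refineStage_spec tie
    (ε := ε / (2 * (S : ℝ) ^ k * H) / 16) (by positivity) hk t D hx.isEndo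
    (fun I s π => mixValue M h t Φ (x.ψ s) I s π) hD
    (fun I _ s J π hπ => mixValue_restrict hM hS h t hcover.2 (hx.isEndo.endo s) I s hπ)
    (fun I _ s => mixValue_factor hM h t hcover.2 (hx.isEndo.endo s) I s)
  refine ⟨x', hsome, hendo, fun s π => ?_⟩
  have h1 := hx.occ_le s π
  have h2 := occ_switch_le hM hS hη ht hcover hcard (hx.isEndo.endo s) s (hpol s)
    (fun π hπ => hopt s π (mem_policiesUpTo.2 ⟨Istar, hk, hπ⟩)) π
  rw [hψ s]
  have h3 : 2 * (S : ℝ) ^ k * (16 * (ε / (2 * (S : ℝ) ^ k * H) / 16)) = ε / H := by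
    field_simp
  rw [h3] at h2
  push_cast at h1
  linarith

/-- With `k = 0` there are no endogenous factors and no data, and the refinement cannot fail. -/
theorem Stage.IsGood.refine_zero (hk : Istar.card ≤ 0) (hε : 0 < ε) (tie : TieBreak d S A)
    {t : Fin H} (ht : t < h) {x : Stage d S A H} (hx : x.IsEndo Istar) {ε₀ : ℝ} (hε₀ : 0 ≤ ε₀)
    (D : Fin 0 → Sample d S A H) :
    ∃ x', refineStage tie 0 ε₀ t D x = some x' ∧ x'.IsGood M h Istar ε t := by
  obtain ⟨x', hsome, hendo, -⟩ := refineStage_spec tie hε₀ hk t D hx (fun _ _ _ => 0)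
    (fun I _ s π _ => by simp [estimate])
    (fun I _ s J π _ => ⟨fun _ => 0, fun _ _ _ => rfl, le_rfl⟩)
    (fun I _ s => ⟨0, le_rfl, zero_le_one, fun _ _ => by simp⟩)
  refine ⟨x', hsome, hendo, fun s π => ?_⟩
  have ht' : (t : ℝ) ≤ h := by exact_mod_cast (Fin.lt_def.1 ht).le
  rw [Finset.card_eq_zero.1 (Nat.le_zero.1 hk), occ_empty, occ_empty]
  have : 0 ≤ ((h : ℝ) - t) * (ε / H) := mul_nonneg (by linarith) (by positivity)
  linarith

/-- One backward step preserves the invariant, except with probability `δ / H`. -/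
theorem refine_failure_le (hM : IsExoMDP M Istar) (hd : 1 ≤ d) (hS : 1 ≤ S)
    (hk : Istar.card ≤ k) {η : ℝ} (hη : IsReachable H M Istar η) (hε : 0 < ε) (hε1 : ε ≤ 1)
    {δ : ℝ} (hδ0 : 0 < δ) (hδ1 : δ < 1) {C : ℝ} (hC : 98304 ≤ C) (tie : TieBreak d S A)
    {t : Fin H} (ht : t < h) {Φ : Finset (Policy d S A H)}
    (hcover : IsEndoCover M Istar t (η / 2) Φ) (hcard : Φ.card ≤ S ^ k) {x : Stage d S A H}
    (hx : x.IsGood M h Istar ε (t + 1)) :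
    (iid (sampleLaw h (fun π => episodeLaw M π h h.isLt) t ht Φ x.policies)
        ⌈C * rate d S A H k ε δ⌉₊).toOuterMeasure
      {D | ¬ ∃ x', refineStage tie k (ε / (2 * (S : ℝ) ^ k * H) / 16) t D x = some x' ∧
        x'.IsGood M h Istar ε t} ≤ ENNReal.ofReal (δ / H) := by
  classical
  have : NeZero S := ⟨by omega⟩
  rcases Nat.eq_zero_or_pos k with rfl | hk1
  · have hN : ⌈C * rate d S A H 0 ε δ⌉₊ = 0 := by simp [rate]
    rw [hN]
    refine le_of_eq_of_le ?_ zero_le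
    rw [show {D : Fin 0 → Sample d S A H | ¬ ∃ x', refineStage tie 0
      (ε / (2 * (S : ℝ) ^ 0 * H) / 16) t D x = some x' ∧ x'.IsGood M h Istar ε t} = ∅ from
      Set.eq_empty_of_forall_notMem fun D hD => hD
        (Stage.IsGood.refine_zero hk hε tie ht hx.isEndo (by positivity) D)]
    exact MeasureTheory.measure_empty
  · have hA : 1 ≤ A := NeZero.pos A
    have hH : 2 ≤ H := by
      have := h.isLt
      have := Fin.lt_def.1 ht
      omega
    have hS1 : (1 : ℝ) ≤ S := by exact_mod_cast hS
    have hH1 : (1 : ℝ) ≤ H := by exact_mod_cast (by omega : 1 ≤ H)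
    have hk1' : (1 : ℝ) ≤ k := by exact_mod_cast hk1
    have hrate := half_le_rate hd hS hA hH hk1 hε hε1 hδ0 hδ1
    have hN : 0 < ⌈C * rate d S A H k ε δ⌉₊ := Nat.ceil_pos.2 (by nlinarith)
    have hΦ : Φ.Nonempty := by
      obtain ⟨φ, hφ, -⟩ := hcover.1 fun _ => 0
      exact ⟨φ, hφ⟩
    have hτ : ε / (2 * (S : ℝ) ^ k * H) / 16 / (2 * k) ≤ 2 := by
      have hp : (1 : ℝ) ≤ (S : ℝ) ^ k := one_le_pow₀ hS1
      have h1 : ε / (2 * (S : ℝ) ^ k * H) ≤ 1 :=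
        div_le_one_of_le₀ (by nlinarith) (by positivity)
      have h2 : ε / (2 * (S : ℝ) ^ k * H) / 16 ≤ 1 := by linarith
      have h3 := div_le_self (a := ε / (2 * (S : ℝ) ^ k * H) / 16) (by positivity)
        (by linarith : (1 : ℝ) ≤ 2 * k)
      linarith
    have h1 := expect_not_accurate_le M hS ht hk hΦ hx.isEndo
      (τ := ε / (2 * (S : ℝ) ^ k * H) / 16 / (2 * k)) (by positivity) hτ hN
    have h2 := union_bound_le hd hS hA hH hk1 hε hε1 hδ0 hδ1 hC (Nat.le_ceil _)
    refine le_trans ?_ (ENNReal.ofReal_le_ofReal (h1.trans h2))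
    refine le_of_le_of_eq ?_ ((toOuterMeasure_eq_expect _
      {D | ¬ Accurate M h t k Φ x (ε / (2 * (S : ℝ) ^ k * H) / 16 / (2 * k)) D}).trans
      (by congr!))
    refine MeasureTheory.measure_mono fun D hD hacc => hD ?_
    exact hx.refine hM hS hk hη hε tie ht hcover hcard hacc

end

lemma toOuterMeasure_le_one {α : Type*} (p : PMF α) (s : Set α) : p.toOuterMeasure s ≤ 1 := by
  rw [PMF.toOuterMeasure_apply, ← p.tsum_coe]
  exact ENNReal.tsum_le_tsum fun a => Set.indicator_le_self' (fun _ _ => zero_le) a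

/-- If `p` lands outside `G` with probability at most `b`, and from `G` the event `s` has
probability at most `c`, then `s` has probability at most `b + c`. -/
lemma toOuterMeasure_bind_le {α β : Type*} (p : PMF α) (f : α → PMF β) (G : Set α) (s : Set β)
    {b c : ℝ≥0∞} (hb : p.toOuterMeasure Gᶜ ≤ b) (hc : ∀ a ∈ G, (f a).toOuterMeasure s ≤ c) :
    (p.bind f).toOuterMeasure s ≤ b + c := by
  classical
  rw [PMF.toOuterMeasure_bind_apply]
  calc ∑' a, p a * (f a).toOuterMeasure s ≤ ∑' a, (Gᶜ.indicator p a + p a * c) := by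
        refine ENNReal.tsum_le_tsum fun a => ?_
        by_cases ha : a ∈ G
        · exact (mul_le_mul_right (hc a ha) _).trans le_add_self
        · rw [Set.indicator_of_mem (by exact ha)]
          exact (mul_le_of_le_one_right' (toOuterMeasure_le_one _ _)).trans le_self_add
    _ = p.toOuterMeasure Gᶜ + c := by
        rw [ENNReal.tsum_add, ← PMF.toOuterMeasure_apply, ENNReal.tsum_mul_right, p.tsum_coe,
          one_mul]
    _ ≤ b + c := add_le_add_left hb c

section
variable [NeZero A]

/-- If each backward step preserves an invariant except with probability `b`, then all of them do
except with probability `m b`. -/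
lemma backwardSteps_failure_le (tie : TieBreak d S A) (k : ℕ) (ε₀ : ℝ) (N : ℕ) (h : Fin H)
    (env : Policy d S A H → PMF (Fin (h + 1) → State d S)) (Ψ : Fin H → Finset (Policy d S A H))
    (good : ℕ → Stage d S A H → Prop) (b : ℝ≥0∞)
    (hstep : ∀ (t : Fin H) (ht : t < h) (x : Stage d S A H), good (t + 1) x →
      (iid (sampleLaw h env t ht (Ψ t) x.policies) N).toOuterMeasure
        {D | ¬ ∃ x', refineStage tie k ε₀ t D x = some x' ∧ good t x'} ≤ b)
    (m : ℕ) (hm : m ≤ h) (r : Run d S A H) (x : Stage d S A H) (hr : r.stage = some x)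
    (hx : good m x) :
    (backwardSteps tie k ε₀ N h env Ψ m hm r).toOuterMeasure
      {r' | ¬ ∃ x', r'.stage = some x' ∧ good 0 x'} ≤ m * b := by
  induction m generalizing r x with
  | zero =>
    refine le_of_eq_of_le ?_ zero_le
    rw [backwardSteps, PMF.toOuterMeasure_pure_apply, if_neg]
    exact fun hn => hn ⟨x, hr, hx⟩
  | succ m ih =>
    rw [backwardSteps, Nat.cast_succ, add_mul, one_mul, add_comm]
    refine toOuterMeasure_bind_le _ _ {r' | ∃ x', r'.stage = some x' ∧ good m x'} _ ?_ ?_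
    · simp only [backwardStep, hr]
      rw [PMF.toOuterMeasure_map_apply]
      exact hstep ⟨m, lt_trans (Nat.lt_of_succ_le hm) h.isLt⟩ _ x hx
    · rintro r' ⟨x', hr', hx'⟩
      exact ih _ r' x' hr' hx'

lemma backwardSteps_episodes_le (tie : TieBreak d S A) (k : ℕ) (ε₀ : ℝ) (N : ℕ) (h : Fin H)
    (env : Policy d S A H → PMF (Fin (h + 1) → State d S)) (Ψ : Fin H → Finset (Policy d S A H))
    (m : ℕ) (hm : m ≤ h) (r : Run d S A H) :
    ∀ r' ∈ (backwardSteps tie k ε₀ N h env Ψ m hm r).support,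
      r'.episodes ≤ r.episodes + m * N := by
  induction m generalizing r with
  | zero =>
    intro r' hr'
    rw [backwardSteps, PMF.mem_support_pure_iff] at hr'
    simp [hr']
  | succ m ih =>
    intro r' hr'
    rw [backwardSteps, PMF.mem_support_bind_iff] at hr'
    obtain ⟨r₁, hr₁, hr'⟩ := hr'
    have h1 := ih (Nat.le_of_succ_le hm) r₁ r' hr'
    have h2 : r₁.episodes ≤ r.episodes + N := by
      unfold backwardStep at hr₁
      split at hr₁
      · rw [PMF.mem_support_pure_iff] at hr₁
        rw [hr₁]
        exact Nat.le_add_right _ _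
      · rw [PMF.mem_support_map_iff] at hr₁
        obtain ⟨D, -, rfl⟩ := hr₁
        exact le_rfl
    rw [Nat.succ_mul]
    omega

/-- At the end of the backward steps the invariant says that the policies form a cover. -/
lemma Stage.IsGood.isEndoCover {M : MDP d S A} {h : Fin H} {Istar : Finset (Fin d)} {ε : ℝ}
    (hε : 0 < ε) {x : Stage d S A H} (hx : x.IsGood M h Istar ε 0) :
    IsEndoCover M Istar h ε x.policies := by
  refine ⟨fun s => ⟨x.ψ s, x.mem_policies s, ?_⟩, fun ψ hψ => ?_⟩
  · have : Nonempty (Policy d S A H) := ⟨idlePolicy⟩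
    rw [sub_le_iff_le_add]
    refine ciSup_le fun π => (hx.occ_le s π).trans ?_
    have hH0 : (0 : ℝ) < H := by exact_mod_cast Fin.pos h
    have hh : (h : ℝ) ≤ H := by exact_mod_cast h.isLt.le
    have h1 : ((h : ℝ) - (0 : ℕ)) * (ε / H) ≤ ε := by
      rw [Nat.cast_zero, sub_zero, mul_div_assoc', div_le_iff₀ hH0]
      nlinarith
    have h2 : switch 0 π (x.ψ s) = x.ψ s := by
      funext i
      simp [switch]
    rw [h2]
    linarith
  · obtain ⟨s, -, rfl⟩ := Finset.mem_image.1 hψ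
    exact hx.isEndo.endo s

end

end ExoRL

end

theorem mainTheorem2 :
    ∃ C₀ : ℝ, 0 < C₀ ∧ ∀ C : ℝ, C₀ ≤ C → ∃ K : ℝ, 0 < K ∧
      ∀ (d S A H k : ℕ) [NeZero A], 1 ≤ d → 1 ≤ S →
      ∀ (M : ExoRL.MDP d S A) (Istar : Finset (Fin d)),
        ExoRL.IsExoMDP M Istar → Istar.card ≤ k →
      ∀ η : ℝ, 0 < η → ExoRL.IsReachable H M Istar η →
      ∀ ε δ : ℝ, 0 < ε → ε ≤ 1 → 0 < δ → δ < 1 →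
      ∀ (h : Fin H) (Ψ : Fin H → Finset (ExoRL.Policy d S A H)),
        (∀ t, t < h → ExoRL.IsEndoCover M Istar t (η / 2) (Ψ t) ∧ (Ψ t).card ≤ S ^ k) →
      ∀ tie : ExoRL.TieBreak d S A,
        let law := ExoRL.ossr C tie k ε δ h (fun π => ExoRL.episodeLaw M π h h.isLt) Ψ
        ENNReal.ofReal (1 - δ) ≤
            law.toOuterMeasure {r | ∃ Φ : Finset (ExoRL.Policy d S A H),
              r.1 = some Φ ∧ ExoRL.IsEndoCover M Istar h ε Φ ∧ Φ.card ≤ S ^ k} ∧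
          ∀ r ∈ law.support, (r.2 : ℝ) ≤ (h : ℕ) * (K * ExoRL.rate d S A H k ε δ) := by
  refine ⟨98304, by norm_num, fun C hC => ⟨C + 2, by linarith, ?_⟩⟩
  intro d S A H k _ hd hS M Istar hM hk η _ hreach ε δ hε hε1 hδ0 hδ1 h Ψ hΨ tie law
  have hH0 : (0 : ℝ) < H := by exact_mod_cast Fin.pos h
  constructor
  · set good := {r : Option (Finset (ExoRL.Policy d S A H)) × ℕ |
      ∃ Φ : Finset (ExoRL.Policy d S A H),
        r.1 = some Φ ∧ ExoRL.IsEndoCover M Istar h ε Φ ∧ Φ.card ≤ S ^ k} with hgood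
    have hbad : law.toOuterMeasure goodᶜ ≤ ENNReal.ofReal δ := by
      have h1 := ExoRL.backwardSteps_failure_le tie k (ε / (2 * (S : ℝ) ^ k * H) / 16)
        ⌈C * ExoRL.rate d S A H k ε δ⌉₊ h (fun π => ExoRL.episodeLaw M π h h.isLt) Ψ
        (fun n x => x.IsGood M h Istar ε n) (ENNReal.ofReal (δ / H))
        (fun t ht x hx => ExoRL.refine_failure_le hM hd hS hk hreach hε hε1 hδ0 hδ1 hC tie ht
          (hΨ t ht).1 (hΨ t ht).2 hx)
        h le_rfl ⟨some ⟨∅, fun _ => ExoRL.idlePolicy⟩, 0⟩ _ rfl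
        ⟨⟨by simp, fun _ _ _ => rfl, fun _ _ _ _ _ => rfl⟩, fun s π => by
          rw [ExoRL.occ_switch_self]; simp⟩
      refine le_trans ?_ (h1.trans ?_)
      · change (PMF.map _ _).toOuterMeasure _ ≤ _
        rw [PMF.toOuterMeasure_map_apply]
        refine MeasureTheory.measure_mono fun r hr hn => hr ?_
        obtain ⟨x, hx, hg⟩ := hn
        exact ⟨x.policies, by simp [hx], hg.isEndoCover hε,
          x.card_policies_le hS hk hg.isEndo⟩
      · rw [← ENNReal.ofReal_natCast, ← ENNReal.ofReal_mul (by positivity)]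
        refine ENNReal.ofReal_le_ofReal ?_
        have hh : (h : ℝ) ≤ H := by exact_mod_cast h.isLt.le
        rw [mul_div_assoc', div_le_iff₀ hH0]
        nlinarith
    have hone : 1 ≤ law.toOuterMeasure good + law.toOuterMeasure goodᶜ := by
      rw [← (law.toOuterMeasure_apply_eq_one_iff (s := Set.univ)).2 (Set.subset_univ _),
        ← Set.union_compl_self good]
      exact MeasureTheory.measure_union_le _ _
    rw [ENNReal.ofReal_sub _ hδ0.le, ENNReal.ofReal_one, tsub_le_iff_right]
    exact hone.trans (add_le_add_right hbad _)
  · intro r hr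
    obtain ⟨r', hr', rfl⟩ := (PMF.mem_support_map_iff _ _ _).1 hr
    have h1 := ExoRL.backwardSteps_episodes_le tie k _ _ h _ Ψ h le_rfl _ r' hr'
    rw [zero_add] at h1
    have h2 : (r'.episodes : ℝ) ≤ (h : ℕ) * (⌈C * ExoRL.rate d S A H k ε δ⌉₊ : ℝ) := by
      exact_mod_cast h1
    rcases Nat.eq_zero_or_pos (h : ℕ) with h0 | h0
    · rw [h0] at h2 ⊢
      simpa using h2
    refine h2.trans (mul_le_mul_of_nonneg_left ?_ (by positivity))
    rcases Nat.eq_zero_or_pos k with rfl | hk1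
    · simp [ExoRL.rate]
    · have hrate := ExoRL.half_le_rate hd hS (NeZero.pos A)
        (by have := h.isLt; omega : 2 ≤ H) hk1 hε hε1 hδ0 hδ1
      have h3 := Nat.ceil_lt_add_one (mul_nonneg (by linarith : 0 ≤ C) (by linarith) :
        0 ≤ C * ExoRL.rate d S A H k ε δ)
      linarith
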